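/- For $N\in\mathbb N$ let $\mathcal Q_N=\{-1,1\}^N$ and let $(g_N(\sigma))_{\sigma\in\mathcal Q_N}$ be i.i.d. standard Gaussian random variables; the variables for all $N$ live on one probability space, with an arbitrary joint law for different $N$. On $\ell^2(\mathcal Q_N)$ let $(T\psi)(\sigma)=-\sum_{j=1}^N\psi(\sigma_1,\dots,-\sigma_j,\dots,\sigma_N)$, let $U(\sigma)=\sqrt N\,g_N(\sigma)$ act by multiplication, and put $H=\Gamma T+U$ and $$p_N(\beta,\Gamma)=\frac1N\ln\left(2^{-N}\,\mathrm{Tr}\,e^{-\beta H}\right).$$ Let $\beta_c=\sqrt{2\ln 2}$, let $p^{\mathrm{REM}}(\beta)=\tfrac12\beta^2$ for $\beta\le\beta_c$ and $p^{\mathrm{REM}}(\beta)=\tfrac12\beta_c^2+(\beta-\beta_c)\beta_c$ for $\beta>\beta_c$, let $p^{\mathrm{PAR}}(x)=\ln\cosh x$, and let $p(\beta,\Gamma)=\max\{p^{\mathrm{REM}}(\beta),\,p^{\mathrm{PAR}}(\beta\Gamma)\}$. (1) For all $\beta,\Gamma\ge 0$, almost surely $\lim_{N\to\infty}p_N(\beta,\Gamma)=p(\beta,\Gamma)$.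 (2) (First-order transition.) For $\beta>0$ let $\Gamma_c(\beta)=\beta^{-1}\operatorname{arcosh}\left(e^{p^{\mathrm{REM}}(\beta)}\right)$. For $\Gamma\ge0$, $p^{\mathrm{PAR}}(\beta\Gamma)<p^{\mathrm{REM}}(\beta)$ if and only if $\Gamma<\Gamma_c(\beta)$, and $p^{\mathrm{PAR}}(\beta\Gamma)>p^{\mathrm{REM}}(\beta)$ if and only if $\Gamma>\Gamma_c(\beta)$. At $\Gamma=\Gamma_c(\beta)$ the left derivative of $\Gamma\mapsto p(\beta,\Gamma)$ is $0$ and its right derivative is $\beta\tanh(\beta\Gamma_c(\beta))>0$. (3) (Freezing transition.) For $\beta>0$ and $0\le\Gamma<\Gamma_c(\beta)$ one has $\frac{\partial p}{\partial\beta}(\beta,\Gamma)=\min\{\beta,\beta_c\}$, and the limiting specific entropy $\ln 2+p-\beta\,\frac{\partial p}{\partial\beta}$ vanishes at $(\beta,\Gamma)$ if and only if $\beta\ge\beta_c$. -/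

import Mathlib

open MeasureTheory ProbabilityTheory Filter Topology

namespace QREM

/-- The configuration space `{-1, 1}^N`; the two signs are the units of `ℤ`. -/
abbrev Config (N : ℕ) : Type := Fin N → ℤˣ

/-- The flip operator `F_j`, which changes the sign of the `j`-th component. -/
def flip {N : ℕ} (j : Fin N) (σ : Config N) : Config N := Function.update σ j (-σ j)

/-- The transversal field, as a matrix on `ℓ²({-1, 1}^N)`: the lemma below gives its action
`(T ψ)(σ) = - ∑ j, ψ (F_j σ)`. -/
def transverseField (N : ℕ) : Matrix (Config N) (Config N) ℂ :=
  Matrix.of fun σ τ => -∑ j : Fin N, if τ = flip j σ then 1 else 0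

theorem transverseField_mulVec {N : ℕ} (ψ : Config N → ℂ) (σ : Config N) :
    (transverseField N).mulVec ψ σ = -∑ j : Fin N, ψ (flip j σ) := by
  simp only [transverseField, Matrix.mulVec, dotProduct, Matrix.of_apply, neg_mul,
    Finset.sum_neg_distrib, Finset.sum_mul]
  rw [Finset.sum_comm]
  simp

/-- The potential `U(σ) = √N g(σ)` for a realization `g` of the Gaussian variables. -/
noncomputable def potential {N : ℕ} (g : Config N → ℝ) (σ : Config N) : ℝ :=
  Real.sqrt N * g σ

/-- The Hamiltonian `H = Γ T + U`, where `U` acts by multiplication. -/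
noncomputable def hamiltonian {N : ℕ} (Γ : ℝ) (g : Config N → ℝ) :
    Matrix (Config N) (Config N) ℂ :=
  (Γ : ℂ) • transverseField N + Matrix.diagonal fun σ => (potential g σ : ℂ)

/-- The partition function `Z(β, Γ) = 2^(-N) Tr exp(-β H)`. As `H` is Hermitian the trace is a
real number, so taking the real part only changes the type. -/
noncomputable def partitionFunction {N : ℕ} (β Γ : ℝ) (g : Config N → ℝ) : ℝ :=
  ((2 : ℝ) ^ N)⁻¹ * (Matrix.trace (NormedSpace.exp (-(β : ℂ) • hamiltonian Γ g))).re

/-- The pressure `p_N(β, Γ) = N⁻¹ ln Z(β, Γ)`. -/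
noncomputable def pressure {N : ℕ} (β Γ : ℝ) (g : Config N → ℝ) : ℝ :=
  (N : ℝ)⁻¹ * Real.log (partitionFunction β Γ g)

/-- The freezing inverse temperature `β_c = √(2 ln 2)`. -/
noncomputable def betaC : ℝ := Real.sqrt (2 * Real.log 2)

/-- The limiting pressure of the random energy model. -/
noncomputable def pREM (β : ℝ) : ℝ :=
  if β ≤ betaC then β ^ 2 / 2 else betaC ^ 2 / 2 + (β - betaC) * betaC

/-- The pressure of the quantum paramagnet, `ln cosh`. -/
noncomputable def pPAR (x : ℝ) : ℝ := Real.log (Real.cosh x)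

/-- Goldschmidt's formula for the limiting pressure. -/
noncomputable def pQREM (β Γ : ℝ) : ℝ := max (pREM β) (pPAR (β * Γ))

/-- The critical field `Γ_c(β) = β⁻¹ arcosh (exp (p^REM(β)))`, used for `β > 0`. -/
noncomputable def gammaC (β : ℝ) : ℝ := β⁻¹ * Real.arcosh (Real.exp (pREM β))

end QREM

/-! The limit is a maximum because the two parts of `H` act on essentially separate subspaces:
configurations with an extensively negative potential are so sparse that the transversal field
barely couples them to the rest.

Lower bound. Peierls' inequality bounds the trace from below by the sum of exponentials of the
diagonal entries in any orthonormal basis. The standard basis yields the REM partition function, as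
`T` has zero diagonal. The characters of the hypercube diagonalize `T` and have constant modulus, so
there the potential contributes only its average over configurations, which is almost surely `o(N)`;
this yields `cosh (β Γ) ^ N`.

Upper bound (`partitionFunction_le`). Let `L` be the set where `U < -ε N`. If every configuration
has at most `δ ^ 2 * N` neighbours in `L`, the edges touching `L` have quadratic form at most `2 δ
N`. Discarding them, and replacing `-β U` by the bound `β ε N` off `L`, leaves a kinetic matrix off
`L` and a diagonal matrix on `L` whose products vanish. The exponential then splits into a sum, with
traces bounded by those of the paramagnet and of the REM. The hypothesis on `L` holds eventually: `δ
^ 2 * N` independent deep levels cost `exp (-c N ^ 2)`, against at most `4 ^ N` choices.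

The REM itself: Markov's inequality up to `β_c` and comparison of power sums beyond it give the
upper bound; Chebyshev's inequality for the number of levels below `-x N`, `x < β_c`, gives the
lower one. Every probability bound is summable in `N`, so Borel-Cantelli applies whatever the joint
law for different `N`. The transitions then follow by calculus from the explicit limit. -/

namespace QREM

/-! ### Convexity and monotonicity of the trace of a matrix exponential -/

section TraceInequalities

open Matrix

theorem conj_apply_self {n : Type*} [Fintype n] (B U : Matrix n n ℂ) (i : n) :
    (star U * B * U) i i = star (fun k => U k i) ⬝ᵥ B *ᵥ (fun k => U k i) := by
  rw [mul_assoc, Matrix.mul_apply]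
  rfl

variable {n : Type*} [Fintype n] [DecidableEq n]

theorem exp_unitary_conj (U : Matrix.unitaryGroup n ℂ) (A : Matrix n n ℂ) :
    NormedSpace.exp ((U : Matrix n n ℂ) * A * star (U : Matrix n n ℂ)) =
      (U : Matrix n n ℂ) * NormedSpace.exp A * star (U : Matrix n n ℂ) := by
  have hU : (U : Matrix n n ℂ)⁻¹ = star (U : Matrix n n ℂ) :=
    Matrix.inv_eq_right_inv (Unitary.mul_star_self_of_mem U.2)
  have hunit : IsUnit (U : Matrix n n ℂ) :=
    ⟨⟨U, star U, Unitary.mul_star_self_of_mem U.2, Unitary.star_mul_self_of_mem U.2⟩, rfl⟩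
  rw [← hU]
  exact Matrix.exp_conj _ _ hunit

theorem trace_unitary_conj (U : Matrix.unitaryGroup n ℂ) (A : Matrix n n ℂ) :
    ((U : Matrix n n ℂ) * A * star (U : Matrix n n ℂ)).trace = A.trace := by
  rw [Matrix.trace_mul_comm, ← mul_assoc, Unitary.star_mul_self_of_mem U.2, one_mul]

theorem unitary_row_sum (U : Matrix.unitaryGroup n ℂ) (i : n) :
    ∑ k, Complex.normSq ((U : Matrix n n ℂ) i k) = 1 := by
  have h : ((U : Matrix n n ℂ) * star (U : Matrix n n ℂ)) i i = 1 := by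
    rw [Unitary.mul_star_self_of_mem U.2, Matrix.one_apply_eq]
  simp only [Matrix.mul_apply, Matrix.star_apply, RCLike.star_def, Complex.mul_conj] at h
  exact_mod_cast h

theorem conj_diagonal_apply_self (U : Matrix.unitaryGroup n ℂ) (d : n → ℝ) (i : n) :
    ((U : Matrix n n ℂ) * diagonal (fun k => (d k : ℂ)) * star (U : Matrix n n ℂ)) i i =
      ((∑ k, Complex.normSq ((U : Matrix n n ℂ) i k) * d k : ℝ) : ℂ) := by
  rw [Matrix.mul_apply]
  push_cast
  refine Finset.sum_congr rfl fun k _ => ?_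
  rw [Matrix.mul_diagonal, Matrix.star_apply, RCLike.star_def, mul_right_comm, Complex.mul_conj]

theorem exp_diagonal_ofReal (d : n → ℝ) :
    NormedSpace.exp (diagonal fun k => (d k : ℂ)) = diagonal fun k => ((Real.exp (d k) : ℝ) : ℂ) := by
  rw [Matrix.exp_diagonal]
  congr 1
  funext k
  rw [Complex.ofReal_exp, Complex.exp_eq_exp_ℂ]
  exact Pi.coe_exp (fun k => (d k : ℂ)) k

theorem _root_.Matrix.IsHermitian.eq_conj_diagonal {B : Matrix n n ℂ} (hB : B.IsHermitian) :
    B = (hB.eigenvectorUnitary : Matrix n n ℂ) * diagonal (fun k => (hB.eigenvalues k : ℂ)) *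
      star (hB.eigenvectorUnitary : Matrix n n ℂ) := by
  have h := hB.spectral_theorem
  rw [Unitary.conjStarAlgAut_apply] at h
  exact h

/-- Peierls' inequality in the standard basis. -/
theorem sum_exp_diag_le_trace_exp {B : Matrix n n ℂ} (hB : B.IsHermitian) :
    ∑ i, Real.exp (B i i).re ≤ (NormedSpace.exp B).trace.re := by
  rw [Matrix.trace, Complex.re_sum]
  refine Finset.sum_le_sum fun i _ => ?_
  set U := hB.eigenvectorUnitary
  have h1 : (B i i).re =
      ∑ k, Complex.normSq ((U : Matrix n n ℂ) i k) * hB.eigenvalues k := by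
    conv_lhs => rw [hB.eq_conj_diagonal]
    rw [conj_diagonal_apply_self, Complex.ofReal_re]
  have h2 : ((NormedSpace.exp B).diag i).re =
      ∑ k, Complex.normSq ((U : Matrix n n ℂ) i k) * Real.exp (hB.eigenvalues k) := by
    conv_lhs => rw [hB.eq_conj_diagonal]
    rw [exp_unitary_conj, exp_diagonal_ofReal, Matrix.diag_apply, conj_diagonal_apply_self,
      Complex.ofReal_re]
  rw [h1, h2]
  -- Jensen's inequality: the squared moduli in a row of a unitary matrix are probability weights.
  have := convexOn_exp.map_sum_le (t := Finset.univ)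
    (w := fun k => Complex.normSq ((U : Matrix n n ℂ) i k)) (p := hB.eigenvalues)
    (fun k _ => Complex.normSq_nonneg _) (unitary_row_sum U i) (fun _ _ => Set.mem_univ _)
  simpa only [smul_eq_mul] using this

/-- Peierls' inequality in an arbitrary orthonormal basis. -/
theorem sum_exp_conj_diag_le_trace_exp {B : Matrix n n ℂ} (hB : B.IsHermitian)
    (U : Matrix.unitaryGroup n ℂ) :
    ∑ i, Real.exp ((star (U : Matrix n n ℂ) * B * (U : Matrix n n ℂ)) i i).re ≤
      (NormedSpace.exp B).trace.re := by
  have hB' : (star (U : Matrix n n ℂ) * B * (U : Matrix n n ℂ)).IsHermitian := by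
    have := Matrix.isHermitian_conjTranspose_mul_mul (U : Matrix n n ℂ) hB
    exact this
  refine (sum_exp_diag_le_trace_exp hB').trans (le_of_eq ?_)
  have h := exp_unitary_conj (star U) B
  have h' := trace_unitary_conj (star U) (NormedSpace.exp B)
  simp only [Unitary.coe_star, star_star] at h h'
  rw [h, h']

theorem trace_exp_conj_diagonal (U : Matrix.unitaryGroup n ℂ) (d : n → ℝ) :
    (NormedSpace.exp ((U : Matrix n n ℂ) * diagonal (fun k => (d k : ℂ)) *
      star (U : Matrix n n ℂ))).trace.re = ∑ k, Real.exp (d k) := by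
  rw [exp_unitary_conj, trace_unitary_conj, exp_diagonal_ofReal, Matrix.trace_diagonal,
    Complex.re_sum]
  simp only [Complex.ofReal_re]

/-- No commutation is needed: in an eigenbasis of `A` the eigenvalues of `A` are at most the
diagonal entries of `B`, and Peierls' inequality for `B` in that basis concludes. -/
theorem trace_exp_mono {A B : Matrix n n ℂ} (hA : A.IsHermitian) (hB : B.IsHermitian)
    (h : ∀ v : n → ℂ, (star v ⬝ᵥ A *ᵥ v).re ≤ (star v ⬝ᵥ B *ᵥ v).re) :
    (NormedSpace.exp A).trace.re ≤ (NormedSpace.exp B).trace.re := by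
  set U := hA.eigenvectorUnitary
  have hdiag : star (U : Matrix n n ℂ) * A * (U : Matrix n n ℂ) =
      diagonal fun k => (hA.eigenvalues k : ℂ) := by
    conv_lhs => rw [hA.eq_conj_diagonal]
    have hU := Unitary.star_mul_self_of_mem U.2
    calc _ = (star (U : Matrix n n ℂ) * U) * diagonal (fun k => (hA.eigenvalues k : ℂ)) *
          (star (U : Matrix n n ℂ) * U) := by simp only [mul_assoc]; rfl
      _ = _ := by rw [hU, one_mul, mul_one]
  calc (NormedSpace.exp A).trace.re = ∑ i, Real.exp (hA.eigenvalues i) := by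
        conv_lhs => rw [hA.eq_conj_diagonal]
        exact trace_exp_conj_diagonal _ _
    _ ≤ ∑ i, Real.exp ((star (U : Matrix n n ℂ) * B * (U : Matrix n n ℂ)) i i).re := by
        refine Finset.sum_le_sum fun i _ => Real.exp_le_exp.2 ?_
        have := h fun k => (U : Matrix n n ℂ) k i
        rw [← conj_apply_self, ← conj_apply_self, hdiag, diagonal_apply_eq,
          Complex.ofReal_re] at this
        exact this
    _ ≤ _ := sum_exp_conj_diag_le_trace_exp hB U

open scoped Matrix.Norms.Operator in
theorem hasSum_exp (X : Matrix n n ℂ) :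
    HasSum (fun k : ℕ => (k.factorial⁻¹ : ℂ) • X ^ k) (NormedSpace.exp X) :=
  NormedSpace.exp_series_hasSum_exp' (𝕂 := ℂ) X

theorem add_pow_of_mul_eq_zero {X Y : Matrix n n ℂ} (hXY : X * Y = 0) (hYX : Y * X = 0) (k : ℕ) :
    (X + Y) ^ (k + 1) = X ^ (k + 1) + Y ^ (k + 1) := by
  induction k with
  | zero => simp
  | succ k ih =>
    have h1 : X ^ (k + 1) * Y = 0 := by rw [pow_succ, mul_assoc, hXY, mul_zero]
    have h2 : Y ^ (k + 1) * X = 0 := by rw [pow_succ, mul_assoc, hYX, mul_zero]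
    rw [pow_succ, ih, add_mul, mul_add, mul_add, h1, h2, ← pow_succ, ← pow_succ, add_zero, zero_add]

/-- If `X Y = Y X = 0`, the exponentials add up, apart from the identity. -/
theorem exp_add_of_mul_eq_zero {X Y : Matrix n n ℂ} (hXY : X * Y = 0) (hYX : Y * X = 0) :
    NormedSpace.exp (X + Y) = NormedSpace.exp X + NormedSpace.exp Y - 1 := by
  refine (hasSum_exp (X + Y)).unique ?_
  -- The degree-zero term is the only one counted twice.
  have h1 : HasSum (fun k : ℕ => if k = 0 then (1 : Matrix n n ℂ) else 0) 1 :=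
    hasSum_ite_eq 0 1
  refine (((hasSum_exp X).add (hasSum_exp Y)).sub h1).congr_fun ?_
  intro k
  cases k with
  | zero => simp
  | succ k => simp [add_pow_of_mul_eq_zero hXY hYX]

theorem hasSum_trace_exp (X : Matrix n n ℂ) :
    HasSum (fun k : ℕ => (k.factorial : ℝ)⁻¹ * (X ^ k).trace.re) (NormedSpace.exp X).trace.re := by
  have hc : Continuous fun M : Matrix n n ℂ => M.trace.re :=
    Complex.continuous_re.comp continuous_id.matrix_trace
  have h := (hasSum_exp X).map
    (Complex.reAddGroupHom.comp (Matrix.traceAddMonoidHom n ℂ)) hc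
  refine h.congr_fun fun k => ?_
  simp [Matrix.trace_smul]

/-- The trace of the exponential is monotone in the entries of a nonnegative matrix. -/
theorem trace_exp_le_of_entrywise {x a : Matrix n n ℝ} (hx : ∀ i j, 0 ≤ x i j)
    (hxa : ∀ i j, x i j ≤ a i j) :
    (NormedSpace.exp (x.map Complex.ofReal)).trace.re ≤
      (NormedSpace.exp (a.map Complex.ofReal)).trace.re := by
  have hpow : ∀ k : ℕ, ∀ i j, 0 ≤ (x ^ k) i j ∧ (x ^ k) i j ≤ (a ^ k) i j := by
    intro k
    induction k with
    | zero => intro i j; simp [Matrix.one_apply]; split_ifs <;> simp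
    | succ k ih =>
      intro i j
      simp only [pow_succ, Matrix.mul_apply]
      exact ⟨Finset.sum_nonneg fun l _ => mul_nonneg (ih i l).1 (hx l j),
        Finset.sum_le_sum fun l _ => mul_le_mul (ih i l).2 (hxa l j) (hx l j)
          ((ih i l).1.trans (ih i l).2)⟩
  have htr : ∀ (m : Matrix n n ℝ) (k : ℕ), ((m.map Complex.ofReal) ^ k).trace.re =
      ∑ i, (m ^ k) i i := by
    intro m k
    have : (m.map Complex.ofReal) ^ k = (m ^ k).map Complex.ofReal :=
      (map_pow (Complex.ofRealHom.mapMatrix) m k).symm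
    rw [this, Matrix.trace, Complex.re_sum]
    simp
  refine hasSum_le (fun k => ?_) (hasSum_trace_exp _) (hasSum_trace_exp _)
  rw [htr, htr]
  exact mul_le_mul_of_nonneg_left (Finset.sum_le_sum fun i _ => (hpow k i i).2) (by positivity)

theorem trace_exp_add_smul_one (X : Matrix n n ℂ) (c : ℝ) :
    (NormedSpace.exp (X + (c : ℂ) • (1 : Matrix n n ℂ))).trace.re =
      Real.exp c * (NormedSpace.exp X).trace.re := by
  have hc : (c : ℂ) • (1 : Matrix n n ℂ) = diagonal fun _ => (c : ℂ) := by
    ext i j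
    simp [Matrix.one_apply, Matrix.diagonal_apply]
  rw [Matrix.exp_add_of_commute _ _ ((Commute.one_right X).smul_right (c : ℂ)), hc,
    exp_diagonal_ofReal (fun _ => c)]
  simp only [Matrix.trace, Matrix.diag_apply, Matrix.mul_diagonal, ← Finset.sum_mul]
  rw [mul_comm, Complex.re_ofReal_mul]

end TraceInequalities

/-! ### Fourier analysis on the hypercube and the two lower bounds -/

section Hypercube

open Matrix

theorem flip_flip {N : ℕ} (j : Fin N) (σ : Config N) : flip j (flip j σ) = σ := by
  simp [flip]

theorem flip_involutive {N : ℕ} (j : Fin N) : Function.Involutive (flip (N := N) j) := flip_flip j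

theorem flip_ne_self {N : ℕ} (j : Fin N) (σ : Config N) : flip j σ ≠ σ := by
  intro h
  have := congrFun h j
  simp [flip] at this

theorem flip_injective_left {N : ℕ} (σ : Config N) : Function.Injective fun j => flip j σ := by
  intro i j hij
  by_contra hne
  have := congrFun hij i
  simp [flip, Function.update_of_ne hne] at this

theorem sum_comp_flip {N : ℕ} (j : Fin N) (f : Config N → ℝ) : ∑ σ, f (flip j σ) = ∑ σ, f σ :=
  Equiv.sum_comp (flip_involutive j).toPerm f

/-- The adjacency matrix of the hypercube. -/
def adjacency (N : ℕ) : Matrix (Config N) (Config N) ℝ :=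
  Matrix.of fun σ τ => ∑ j : Fin N, if τ = flip j σ then 1 else 0

theorem adjacency_apply {N : ℕ} (σ τ : Config N) :
    adjacency N σ τ = ∑ j : Fin N, if τ = flip j σ then 1 else 0 := rfl

theorem adjacency_nonneg {N : ℕ} (σ τ : Config N) : 0 ≤ adjacency N σ τ := by
  rw [adjacency_apply]
  exact Finset.sum_nonneg fun j _ => by split_ifs <;> norm_num

theorem adjacency_symm {N : ℕ} (σ τ : Config N) : adjacency N σ τ = adjacency N τ σ := by
  rw [adjacency_apply, adjacency_apply]
  refine Finset.sum_congr rfl fun j _ => ?_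
  have : τ = flip j σ ↔ σ = flip j τ := by
    constructor <;> (rintro rfl; rw [flip_flip])
  simp only [this]

theorem sum_adjacency_mul {N : ℕ} (σ : Config N) (f : Config N → ℝ) :
    ∑ τ, adjacency N σ τ * f τ = ∑ j, f (flip j σ) := by
  simp only [adjacency, Matrix.of_apply, Finset.sum_mul]
  rw [Finset.sum_comm]
  simp

theorem map_ofReal_isHermitian {n : Type*} {m : Matrix n n ℝ} (h : ∀ i j, m i j = m j i) :
    (m.map Complex.ofReal).IsHermitian := by
  ext i j
  simp [h i j]

theorem re_quadratic_form_map_ofReal {n : Type*} [Fintype n] (m : Matrix n n ℝ) (v : n → ℂ) :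
    (star v ⬝ᵥ (m.map Complex.ofReal) *ᵥ v).re =
      ∑ i, ∑ j, m i j * (starRingEnd ℂ (v i) * v j).re := by
  simp only [dotProduct, Matrix.mulVec, Complex.re_sum, Finset.mul_sum, Matrix.map_apply,
    Pi.star_apply, RCLike.star_def]
  refine Finset.sum_congr rfl fun i _ => Finset.sum_congr rfl fun j _ => ?_
  rw [mul_left_comm, Complex.re_ofReal_mul]

/-- The real matrix `-β H`. -/
noncomputable def gibbsExponent {N : ℕ} (β Γ : ℝ) (g : Config N → ℝ) :
    Matrix (Config N) (Config N) ℝ :=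
  Matrix.of fun σ τ =>
    β * Γ * adjacency N σ τ + if σ = τ then -(β * potential g σ) else 0

theorem neg_smul_hamiltonian {N : ℕ} (β Γ : ℝ) (g : Config N → ℝ) :
    -(β : ℂ) • hamiltonian Γ g = (gibbsExponent β Γ g).map Complex.ofReal := by
  ext σ τ
  have hT : transverseField N σ τ = -((adjacency N σ τ : ℝ) : ℂ) := by
    simp [transverseField, adjacency]
  simp only [hamiltonian, gibbsExponent, Matrix.smul_apply, Matrix.add_apply, hT,
    Matrix.diagonal_apply, Matrix.map_apply, Matrix.of_apply, smul_eq_mul]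
  split_ifs <;> push_cast <;> ring

theorem gibbsExponent_symm {N : ℕ} (β Γ : ℝ) (g : Config N → ℝ) (σ τ : Config N) :
    gibbsExponent β Γ g σ τ = gibbsExponent β Γ g τ σ := by
  simp only [gibbsExponent, Matrix.of_apply, adjacency_symm σ τ]
  by_cases h : σ = τ
  · simp [h]
  · simp [h, Ne.symm h]

/-- The partition function of the random energy model. -/
noncomputable def remPartition {N : ℕ} (β : ℝ) (g : Config N → ℝ) : ℝ :=
  ((2 : ℝ) ^ N)⁻¹ * ∑ σ, Real.exp (-(β * potential g σ))

theorem remPartition_pos {N : ℕ} (β : ℝ) (g : Config N → ℝ) : 0 < remPartition β g :=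
  mul_pos (by positivity) (Finset.sum_pos (fun _ _ => Real.exp_pos _) Finset.univ_nonempty)

theorem remPartition_le_partitionFunction {N : ℕ} (β Γ : ℝ) (g : Config N → ℝ) :
    remPartition β g ≤ partitionFunction β Γ g := by
  rw [remPartition, partitionFunction, neg_smul_hamiltonian]
  refine mul_le_mul_of_nonneg_left ?_ (by positivity)
  refine le_trans (le_of_eq ?_)
    (sum_exp_diag_le_trace_exp (map_ofReal_isHermitian (gibbsExponent_symm β Γ g)))
  refine Finset.sum_congr rfl fun σ _ => ?_
  have : adjacency N σ σ = 0 := by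
    rw [adjacency_apply]
    exact Finset.sum_eq_zero fun j _ => if_neg (flip_ne_self j σ).symm
  simp [gibbsExponent, this]

/-- The characters of the group `{-1, 1}^N`. -/
noncomputable def character {N : ℕ} (τ σ : Config N) : ℝ :=
  ∏ j, if τ j = 1 then 1 else ((σ j : ℤ) : ℝ)

/-- Each character is thus a common eigenvector of all flips, hence of the adjacency matrix. -/
theorem character_flip {N : ℕ} (τ σ : Config N) (j : Fin N) :
    character τ (flip j σ) = ((τ j : ℤ) : ℝ) * character τ σ := by
  rw [character, character, ← Finset.mul_prod_erase _ _ (Finset.mem_univ j),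
    ← Finset.mul_prod_erase Finset.univ (fun j => if τ j = 1 then (1 : ℝ) else ((σ j : ℤ) : ℝ))
      (Finset.mem_univ j), ← mul_assoc]
  congr 1
  · rcases Int.units_eq_one_or (τ j) with h | h <;> simp [h, flip]
  · refine Finset.prod_congr rfl fun i hi => ?_
    rw [flip, Function.update_of_ne (Finset.ne_of_mem_erase hi)]

theorem character_mul_self {N : ℕ} (τ σ : Config N) : character τ σ * character τ σ = 1 := by
  rw [character, ← Finset.prod_mul_distrib]
  refine Finset.prod_eq_one fun j _ => ?_
  rcases Int.units_eq_one_or (σ j) with h | h <;> split_ifs <;> simp [h]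

theorem sum_config_prod {N : ℕ} (f : Fin N → ℤˣ → ℝ) :
    ∑ σ : Config N, ∏ j, f j (σ j) = ∏ j, (f j 1 + f j (-1)) := by
  have h := Finset.prod_univ_sum (fun _ : Fin N => (Finset.univ : Finset ℤˣ)) f
  rw [Fintype.piFinset_univ] at h
  rw [← h]
  refine Finset.prod_congr rfl fun j _ => ?_
  rw [UnitsInt.univ, Finset.sum_pair (by decide)]

theorem sum_character_mul {N : ℕ} (τ τ' : Config N) :
    ∑ σ, character τ σ * character τ' σ = if τ = τ' then (2 : ℝ) ^ N else 0 := by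
  split_ifs with h
  · subst h
    simp [character_mul_self, Fintype.card_pi]
  · obtain ⟨j, hj⟩ := Function.ne_iff.1 h
    simp only [character, ← Finset.prod_mul_distrib]
    rw [sum_config_prod fun j u => (if τ j = 1 then (1 : ℝ) else ((u : ℤ) : ℝ)) *
      (if τ' j = 1 then (1 : ℝ) else ((u : ℤ) : ℝ))]
    -- Where `τ` and `τ'` differ, exactly one character has the sign as its factor, and `1 + (-1) =
    -- 0`.
    refine Finset.prod_eq_zero (Finset.mem_univ j) ?_
    rcases Int.units_eq_one_or (τ j) with h | h <;>
      rcases Int.units_eq_one_or (τ' j) with h' | h' <;> simp_all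

/-- The normalized character table. -/
noncomputable def characterTable (N : ℕ) : Matrix (Config N) (Config N) ℝ :=
  Matrix.of fun σ τ => (Real.sqrt (2 ^ N))⁻¹ * character τ σ

theorem characterTable_mul_self {N : ℕ} (σ τ : Config N) :
    characterTable N σ τ * characterTable N σ τ = ((2 : ℝ) ^ N)⁻¹ := by
  rw [characterTable, Matrix.of_apply, mul_mul_mul_comm, character_mul_self, mul_one, ← mul_inv,
    Real.mul_self_sqrt (by positivity)]

theorem transpose_mul_characterTable (N : ℕ) : (characterTable N)ᵀ * characterTable N = 1 := by
  ext τ τ'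
  have h : ∀ σ : Config N, characterTable N σ τ * characterTable N σ τ' =
      ((2 : ℝ) ^ N)⁻¹ * (character τ σ * character τ' σ) := by
    intro σ
    rw [characterTable, Matrix.of_apply, Matrix.of_apply, mul_mul_mul_comm, ← mul_inv,
      Real.mul_self_sqrt (by positivity)]
  rw [Matrix.mul_apply, Matrix.one_apply]
  simp only [Matrix.transpose_apply, h]
  rw [← Finset.mul_sum, sum_character_mul]
  split_ifs <;> simp

theorem star_map_ofReal {n : Type*} (m : Matrix n n ℝ) :
    star (m.map Complex.ofReal) = mᵀ.map Complex.ofReal := by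
  ext i j
  simp

theorem map_ofReal_mul {n : Type*} [Fintype n] (m m' : Matrix n n ℝ) :
    (m * m').map Complex.ofReal = m.map Complex.ofReal * m'.map Complex.ofReal :=
  Matrix.map_mul (f := Complex.ofRealHom)

/-- The character table as a unitary matrix. -/
noncomputable def characterUnitary (N : ℕ) : Matrix.unitaryGroup (Config N) ℂ :=
  ⟨(characterTable N).map Complex.ofReal, by
    rw [Matrix.mem_unitaryGroup_iff', star_map_ofReal, ← map_ofReal_mul,
      transpose_mul_characterTable]
    ext i j
    simp [Matrix.one_apply, apply_ite]⟩

/-- The eigenvalues of the adjacency matrix of the hypercube. -/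
def magnetization {N : ℕ} (τ : Config N) : ℝ := ∑ j, ((τ j : ℤ) : ℝ)

theorem adjacency_mul_characterTable (N : ℕ) :
    adjacency N * characterTable N = characterTable N * diagonal magnetization := by
  ext σ τ
  rw [Matrix.mul_apply, sum_adjacency_mul σ fun ρ => characterTable N ρ τ, Matrix.mul_diagonal]
  simp only [characterTable, Matrix.of_apply, character_flip, magnetization, Finset.mul_sum]
  refine Finset.sum_congr rfl fun j _ => ?_
  ring

theorem sum_exp_magnetization (N : ℕ) (t : ℝ) :
    ∑ τ : Config N, Real.exp (t * magnetization τ) = (2 * Real.cosh t) ^ N := by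
  simp only [magnetization, Finset.mul_sum, Real.exp_sum]
  rw [sum_config_prod fun _ u => Real.exp (t * ((u : ℤ) : ℝ))]
  simp only [Finset.prod_const, Finset.card_univ, Fintype.card_fin]
  congr 1
  rw [Real.cosh_eq]
  simp
  ring

theorem trace_exp_adjacency (N : ℕ) (t : ℝ) :
    (NormedSpace.exp ((t • adjacency N).map Complex.ofReal)).trace.re =
      (2 * Real.cosh t) ^ N := by
  have hinv : characterTable N * (characterTable N)ᵀ = 1 :=
    mul_eq_one_comm.1 (transpose_mul_characterTable N)
  have h : t • adjacency N =
      characterTable N * diagonal (fun τ => t * magnetization τ) * (characterTable N)ᵀ := by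
    have h1 : diagonal (fun τ : Config N => t * magnetization τ) = t • diagonal magnetization := by
      rw [← Matrix.diagonal_smul]; rfl
    rw [h1, Matrix.mul_smul, ← adjacency_mul_characterTable, Matrix.smul_mul, mul_assoc, hinv,
      mul_one]
  have h2 := trace_exp_conj_diagonal (characterUnitary N) fun τ => t * magnetization τ
  rw [sum_exp_magnetization] at h2
  rw [← h2, h, map_ofReal_mul, map_ofReal_mul, ← star_map_ofReal, Matrix.diagonal_map (by simp)]
  rfl

/-- Peierls' inequality in the character basis: each basis vector has squared entries `2 ^ (-N)`, so
the potential enters every diagonal element only through its mean. -/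
theorem cosh_pow_mul_exp_le_partitionFunction {N : ℕ} (β Γ : ℝ) (g : Config N → ℝ) :
    Real.cosh (β * Γ) ^ N * Real.exp (-(β * (((2 : ℝ) ^ N)⁻¹ * ∑ σ, potential g σ))) ≤
      partitionFunction β Γ g := by
  have h := sum_exp_conj_diag_le_trace_exp
    (map_ofReal_isHermitian (gibbsExponent_symm β Γ g)) (characterUnitary N)
  have hW : (characterUnitary N : Matrix (Config N) (Config N) ℂ) =
      (characterTable N).map Complex.ofReal := rfl
  have hdec : gibbsExponent β Γ g =
      (β * Γ) • adjacency N + diagonal fun σ => -(β * potential g σ) := by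
    ext σ τ
    simp [gibbsExponent, Matrix.diagonal_apply]
  have hdiag : ∀ τ, ((characterTable N)ᵀ * gibbsExponent β Γ g * characterTable N) τ τ =
      β * Γ * magnetization τ + -(β * (((2 : ℝ) ^ N)⁻¹ * ∑ σ, potential g σ)) := by
    intro τ
    rw [hdec, mul_add, add_mul, Matrix.add_apply]
    congr 1
    · rw [Matrix.mul_smul, Matrix.smul_mul, mul_assoc, adjacency_mul_characterTable, ← mul_assoc,
        transpose_mul_characterTable, one_mul]
      simp
    · rw [Matrix.mul_apply]
      simp only [Matrix.mul_diagonal, Matrix.transpose_apply]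
      simp only [mul_right_comm, characterTable_mul_self, ← Finset.mul_sum]
      rw [Finset.sum_neg_distrib, ← Finset.mul_sum]
      ring
  rw [hW, star_map_ofReal, ← map_ofReal_mul, ← map_ofReal_mul] at h
  simp only [Matrix.map_apply, Complex.ofReal_re, hdiag, Real.exp_add, ← Finset.sum_mul] at h
  rw [sum_exp_magnetization] at h
  rw [partitionFunction, neg_smul_hamiltonian]
  refine le_trans (le_of_eq ?_) (mul_le_mul_of_nonneg_left h (by positivity))
  rw [mul_pow]
  field_simp

end Hypercube

/-! ### Decoupling of the deep levels and the upper bound -/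

section DeepHoles

open Matrix

/-- Bound for the edges of the hypercube which touch a set with few elements near any point. -/
theorem sum_edges_touching_le {N : ℕ} (L : Config N → Prop) [DecidablePred L] {δ : ℝ} (hδ : 0 < δ)
    (hL : ∀ σ, ((Finset.univ.filter fun j => L (flip j σ)).card : ℝ) ≤ δ ^ 2 * N)
    (v : Config N → ℂ) :
    ∑ σ, ∑ j, (if L σ ∨ L (flip j σ) then (starRingEnd ℂ (v σ) * v (flip j σ)).re else 0) ≤
      2 * δ * N * ∑ σ, Complex.normSq (v σ) := by
  set r : Config N → Fin N → ℝ := fun σ j => ‖v σ‖ * ‖v (flip j σ)‖ with hr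
  have h1 : ∀ σ j, (if L σ ∨ L (flip j σ) then (starRingEnd ℂ (v σ) * v (flip j σ)).re else 0) ≤
      (if L σ then r σ j else 0) + (if L (flip j σ) then r σ j else 0) := by
    intro σ j
    have h0 : 0 ≤ r σ j := by positivity
    have hre : (starRingEnd ℂ (v σ) * v (flip j σ)).re ≤ r σ j := by
      refine (Complex.re_le_norm _).trans (le_of_eq ?_)
      rw [norm_mul, Complex.norm_conj]
    by_cases h : L σ <;> by_cases h' : L (flip j σ) <;>
      simp only [h, h', or_true, or_false, if_true, if_false] <;> linarith
  -- Reversing each edge exchanges its endpoints and preserves `r`.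
  have h2 : ∑ σ, ∑ j, (if L (flip j σ) then r σ j else 0) =
      ∑ σ, ∑ j, (if L σ then r σ j else 0) := by
    rw [Finset.sum_comm]
    conv_rhs => rw [Finset.sum_comm]
    refine Finset.sum_congr rfl fun j _ => ?_
    rw [← sum_comp_flip j fun σ => if L σ then r σ j else 0]
    simp only [hr, flip_flip, mul_comm]
  -- Weighted AM-GM. The weight `δ` balances the `N` edges at a point against the at most `δ ^ 2 *
  -- N` leading into `L`: both terms sum to `δ N ‖v‖ ^ 2`.
  have h3 : ∀ σ j, 2 * (if L σ then r σ j else 0) ≤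
      δ * ‖v σ‖ ^ 2 + δ⁻¹ * (if L σ then ‖v (flip j σ)‖ ^ 2 else 0) := by
    intro σ j
    have h4 : 0 ≤ δ⁻¹ * (δ * ‖v σ‖ - ‖v (flip j σ)‖) ^ 2 := by positivity
    have h5 : δ⁻¹ * (δ * ‖v σ‖ - ‖v (flip j σ)‖) ^ 2 =
        δ * ‖v σ‖ ^ 2 + δ⁻¹ * ‖v (flip j σ)‖ ^ 2 - 2 * r σ j := by
      simp only [hr]
      field_simp
      ring
    split_ifs
    · linarith
    · simp; positivity
  -- Double counting: a point occurs once for each of its neighbours in `L`.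
  have h6 : ∑ σ, ∑ j, (if L σ then ‖v (flip j σ)‖ ^ 2 else 0) ≤
      δ ^ 2 * N * ∑ σ, ‖v σ‖ ^ 2 := by
    rw [Finset.sum_comm]
    have : ∀ j : Fin N, ∑ σ, (if L σ then ‖v (flip j σ)‖ ^ 2 else 0) =
        ∑ σ, (if L (flip j σ) then ‖v σ‖ ^ 2 else 0) := by
      intro j
      rw [← sum_comp_flip j fun σ => if L σ then ‖v (flip j σ)‖ ^ 2 else 0]
      simp only [flip_flip]
    simp only [this]
    rw [Finset.sum_comm, Finset.mul_sum]
    refine Finset.sum_le_sum fun σ _ => ?_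
    rw [← Finset.sum_filter, Finset.sum_const, nsmul_eq_mul]
    exact mul_le_mul_of_nonneg_right (hL σ) (by positivity)
  have h7 : ∑ σ, ∑ j, 2 * (if L σ then r σ j else 0) ≤
      ∑ σ, ∑ j : Fin N,
        (δ * ‖v σ‖ ^ 2 + δ⁻¹ * (if L σ then ‖v (flip j σ)‖ ^ 2 else 0)) :=
    Finset.sum_le_sum fun σ _ => Finset.sum_le_sum fun j _ => h3 σ j
  simp only [Finset.sum_add_distrib, ← Finset.mul_sum, Finset.sum_const, Finset.card_univ,
    Fintype.card_fin, nsmul_eq_mul] at h7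
  have h8 : δ⁻¹ * ∑ σ, ∑ j, (if L σ then ‖v (flip j σ)‖ ^ 2 else 0) ≤
      δ * N * ∑ σ, ‖v σ‖ ^ 2 := by
    refine (mul_le_mul_of_nonneg_left h6 (by positivity)).trans (le_of_eq ?_)
    field_simp
  calc _ ≤ ∑ σ, ∑ j, ((if L σ then r σ j else 0) + (if L (flip j σ) then r σ j else 0)) :=
        Finset.sum_le_sum fun σ _ => Finset.sum_le_sum fun j _ => h1 σ j
    _ = 2 * ∑ σ, ∑ j, (if L σ then r σ j else 0) := by
        simp only [Finset.sum_add_distrib]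
        rw [h2, two_mul]
    _ ≤ _ := by
        simp only [Complex.normSq_eq_norm_sq]
        linarith

theorem quadratic_form_diagonal {n : Type*} [Fintype n] [DecidableEq n] (d : n → ℝ) (v : n → ℂ) :
    ∑ i, ∑ j, diagonal d i j * (starRingEnd ℂ (v i) * v j).re =
      ∑ i, d i * Complex.normSq (v i) := by
  refine Finset.sum_congr rfl fun i _ => ?_
  rw [Finset.sum_eq_single i (fun j _ hj => by simp [Matrix.diagonal_apply_ne _ hj.symm])
    (fun h => absurd (Finset.mem_univ i) h), Matrix.diagonal_apply_eq, mul_comm _ (v i),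
    Complex.mul_conj, Complex.ofReal_re]

/-- If no configuration has too many neighbours with a very low potential, the partition function
is at most the sum of those of the paramagnet and of the random energy model, up to a small
exponential factor. -/
theorem partitionFunction_le {N : ℕ} {β Γ ε δ : ℝ} (hβ : 0 ≤ β) (hΓ : 0 ≤ Γ) (hε : 0 ≤ ε)
    (hδ : 0 < δ) (g : Config N → ℝ)
    (hL : ∀ σ, ((Finset.univ.filter fun j => potential g (flip j σ) < -(ε * N)).card : ℝ) ≤
      δ ^ 2 * N) :
    partitionFunction β Γ g ≤ Real.exp (N * (β * ε + 2 * (β * Γ) * δ)) *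
      (Real.cosh (β * Γ) ^ N + remPartition β g) := by
  classical
  set L : Config N → Prop := fun σ => potential g σ < -(ε * N) with hLdef
  -- The price of the comparison: `β ε N` for the potential off `L`, the rest for the discarded
  -- edges.
  set c : ℝ := N * (β * ε + 2 * (β * Γ) * δ) with hc
  set x : Matrix (Config N) (Config N) ℝ := Matrix.of fun σ τ =>
    if L σ ∨ L τ then 0 else (β * Γ) * adjacency N σ τ with hx
  set y : Config N → ℝ := fun σ => if L σ then -(β * potential g σ) else 0 with hy
  set X := x.map Complex.ofReal with hX
  set Y := diagonal (fun σ => (y σ : ℂ)) with hY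
  have hβΓ : 0 ≤ β * Γ := mul_nonneg hβ hΓ
  have hXY : X * Y = 0 := by
    ext σ τ
    rw [hY, Matrix.mul_diagonal]
    by_cases h : L τ <;> simp [hX, hx, hy, h]
  have hYX : Y * X = 0 := by
    ext σ τ
    rw [hY, Matrix.diagonal_mul]
    by_cases h : L σ <;> simp [hX, hx, hy, h]
  set b' : Matrix (Config N) (Config N) ℝ := x + diagonal (fun σ => y σ + c) with hb'
  have hb'map : b'.map Complex.ofReal = X + Y + (c : ℂ) • (1 : Matrix (Config N) (Config N) ℂ) := by
    ext σ τ
    simp only [hb', hX, hY, Matrix.map_apply, Matrix.add_apply, Matrix.diagonal_apply,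
      Matrix.smul_apply, Matrix.one_apply, smul_eq_mul]
    split_ifs <;> simp [add_assoc]
  have hb'symm : ∀ σ τ, b' σ τ = b' τ σ := by
    intro σ τ
    simp only [hb', hx, Matrix.add_apply, Matrix.of_apply, adjacency_symm σ τ, or_comm (a := L σ),
      Matrix.diagonal_apply]
    by_cases h : σ = τ
    · simp [h]
    · simp [h, Ne.symm h]
  have hform : ∀ v : Config N → ℂ,
      (star v ⬝ᵥ (gibbsExponent β Γ g).map Complex.ofReal *ᵥ v).re ≤
        (star v ⬝ᵥ b'.map Complex.ofReal *ᵥ v).re := by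
    intro v
    rw [re_quadratic_form_map_ofReal, re_quadratic_form_map_ofReal]
    have hg : gibbsExponent β Γ g =
        (β * Γ) • adjacency N + diagonal fun σ => -(β * potential g σ) := by
      ext σ τ
      simp [gibbsExponent, Matrix.diagonal_apply]
    have hsplit : ∀ (m : Matrix (Config N) (Config N) ℝ) (d : Config N → ℝ),
        ∑ σ, ∑ τ, (m + diagonal d) σ τ * (starRingEnd ℂ (v σ) * v τ).re =
          ∑ σ, ∑ τ, m σ τ * (starRingEnd ℂ (v σ) * v τ).re +
            ∑ σ, d σ * Complex.normSq (v σ) := by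
      intro m d
      rw [← quadratic_form_diagonal, ← Finset.sum_add_distrib]
      refine Finset.sum_congr rfl fun σ _ => ?_
      rw [← Finset.sum_add_distrib]
      refine Finset.sum_congr rfl fun τ _ => ?_
      rw [Matrix.add_apply, add_mul]
    rw [hg, hb', hsplit, hsplit]
    have e1 : ∑ σ, ∑ τ, ((β * Γ) • adjacency N) σ τ * (starRingEnd ℂ (v σ) * v τ).re =
        ∑ σ, ∑ τ, x σ τ * (starRingEnd ℂ (v σ) * v τ).re + β * Γ * ∑ σ, ∑ j,
          (if L σ ∨ L (flip j σ) then (starRingEnd ℂ (v σ) * v (flip j σ)).re else 0) := by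
      rw [Finset.mul_sum, ← Finset.sum_add_distrib]
      refine Finset.sum_congr rfl fun σ _ => ?_
      rw [← sum_adjacency_mul σ fun τ => if L σ ∨ L τ then (starRingEnd ℂ (v σ) * v τ).re else 0,
        Finset.mul_sum, ← Finset.sum_add_distrib]
      refine Finset.sum_congr rfl fun τ _ => ?_
      simp only [hx, Matrix.smul_apply, Matrix.of_apply, smul_eq_mul]
      split_ifs <;> ring
    have e2 := mul_le_mul_of_nonneg_left (sum_edges_touching_le L hδ hL v) hβΓ
    have e3 : ∑ σ, -(β * potential g σ) * Complex.normSq (v σ) + β * Γ * (2 * δ * N *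
        ∑ σ, Complex.normSq (v σ)) ≤ ∑ σ, (y σ + c) * Complex.normSq (v σ) := by
      rw [Finset.mul_sum, Finset.mul_sum, ← Finset.sum_add_distrib]
      refine Finset.sum_le_sum fun σ _ => ?_
      have hpt : -(β * potential g σ) ≤ y σ + N * (β * ε) := by
        by_cases h : L σ
        · simp only [hy, h, if_true]
          have : 0 ≤ (N : ℝ) * (β * ε) := by positivity
          linarith
        · simp only [hy, h, if_false]
          have h' : -(ε * N) ≤ potential g σ := not_lt.1 h
          have := mul_le_mul_of_nonneg_left h' hβ
          linarith
      have := mul_le_mul_of_nonneg_right hpt (Complex.normSq_nonneg (v σ))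
      rw [hc]
      linarith
    linarith
  have htr := trace_exp_mono (map_ofReal_isHermitian (gibbsExponent_symm β Γ g))
    (map_ofReal_isHermitian hb'symm) hform
  rw [hb'map, trace_exp_add_smul_one, exp_add_of_mul_eq_zero hXY hYX, Matrix.trace_sub,
    Matrix.trace_add, Complex.sub_re, Complex.add_re] at htr
  have hXtr : (NormedSpace.exp X).trace.re ≤ (2 * Real.cosh (β * Γ)) ^ N := by
    rw [← trace_exp_adjacency]
    refine trace_exp_le_of_entrywise (fun σ τ => ?_) fun σ τ => ?_
    · simp only [hx, Matrix.of_apply]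
      split_ifs
      · exact le_rfl
      · exact mul_nonneg hβΓ (adjacency_nonneg σ τ)
    · simp only [hx, Matrix.of_apply, Matrix.smul_apply, smul_eq_mul]
      split_ifs
      · exact mul_nonneg hβΓ (adjacency_nonneg σ τ)
      · exact le_rfl
  -- Off `L` the entry of `exp Y` is `1`, which the subtracted identity cancels.
  have hYtr : (NormedSpace.exp Y).trace.re - (1 : Matrix (Config N) (Config N) ℂ).trace.re ≤
      ∑ σ, Real.exp (-(β * potential g σ)) := by
    rw [hY, exp_diagonal_ofReal, Matrix.trace_diagonal, Matrix.trace, Complex.re_sum,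
      Complex.re_sum, ← Finset.sum_sub_distrib]
    refine Finset.sum_le_sum fun σ _ => ?_
    have := Real.exp_pos (-(β * potential g σ))
    rw [Complex.ofReal_re, Matrix.diag_apply, Matrix.one_apply_eq, Complex.one_re]
    by_cases h : L σ
    · simp only [hy, h, if_true]; linarith
    · simp only [hy, h, if_false, Real.exp_zero]; linarith
  rw [partitionFunction, neg_smul_hamiltonian, remPartition]
  refine (mul_le_mul_of_nonneg_left htr (by positivity)).trans ?_
  have h2 : Real.cosh (β * Γ) ^ N = ((2 : ℝ) ^ N)⁻¹ * (2 * Real.cosh (β * Γ)) ^ N := by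
    rw [mul_pow]; field_simp
  rw [h2, ← mul_add, mul_left_comm]
  refine mul_le_mul_of_nonneg_left (mul_le_mul_of_nonneg_left ?_ (by positivity))
    (Real.exp_pos c).le
  linarith

end DeepHoles

/-! ### Gaussian tails, Borel-Cantelli and Chebyshev -/

section Gaussian

variable {Ω : Type*} [MeasurableSpace Ω] {P : Measure Ω}

theorem summable_exp_neg_mul {c : ℝ} (hc : 0 < c) : Summable fun N : ℕ => Real.exp (-(N * c)) := by
  have : ∀ N : ℕ, Real.exp (-(N * c)) = Real.exp (-c) ^ N := fun N => by
    rw [← Real.exp_nat_mul]; ring_nf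
  simp only [this]
  exact summable_geometric_of_lt_one (Real.exp_pos _).le 
    (by rw [← Real.exp_zero]; exact Real.exp_lt_exp.2 (by linarith))

theorem eventually_add_mul_sqrt_le (a b : ℝ) {η : ℝ} (hη : 0 < η) :
    ∀ᶠ N : ℕ in atTop, a + b * Real.sqrt N ≤ N * η := by
  have h1 : Tendsto (fun N : ℕ => Real.sqrt N) atTop atTop :=
    Real.tendsto_sqrt_atTop.comp tendsto_natCast_atTop_atTop
  filter_upwards [h1.eventually_ge_atTop ((|a| + |b|) / η + 1)] with N hN
  set s := Real.sqrt N
  have hN' : (N : ℝ) = s * s := (Real.mul_self_sqrt (Nat.cast_nonneg N)).symm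
  have hq : 0 ≤ (|a| + |b|) / η := by positivity
  have hs1 : 1 ≤ s := by linarith
  have h2 : |a| + |b| ≤ s * η := by
    rw [← div_le_iff₀ hη]; linarith
  have h3 : (|a| + |b|) * s ≤ s * η * s := mul_le_mul_of_nonneg_right h2 (by linarith)
  have h4 : a ≤ |a| * s := (le_abs_self a).trans (le_mul_of_one_le_right (abs_nonneg a) hs1)
  have h5 : b * s ≤ |b| * s := mul_le_mul_of_nonneg_right (le_abs_self b) (by linarith)
  rw [hN']
  linarith

variable {X : Ω → ℝ}

theorem mgf_of_hasLaw (hX : HasLaw X (gaussianReal 0 1) P) (t : ℝ) :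
    ∫ ω, Real.exp (t * X ω) ∂P = Real.exp (t ^ 2 / 2) := by
  have := mgf_gaussianReal hX.map_eq t
  simpa [mgf] using this

theorem integrable_exp_of_hasLaw (hX : HasLaw X (gaussianReal 0 1) P) (t : ℝ) :
    Integrable (fun ω => Real.exp (t * X ω)) P := by
  have h := integrable_exp_mul_gaussianReal (μ := 0) (v := 1) t
  rw [← hX.map_eq] at h
  exact h.comp_aemeasurable hX.aemeasurable

/-- The density is at least its value at `-y - 1` on the unit interval `[-y - 1, -y]`. The loss
against the true tail is only `exp (O(y))`, negligible for `y` of order `√N`. -/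
theorem le_gaussian_lower_tail (hX : HasLaw X (gaussianReal 0 1) P) {y : ℝ} (hy : 0 ≤ y) :
    (Real.sqrt (2 * Real.pi))⁻¹ * Real.exp (-((y + 1) ^ 2 / 2)) ≤ P.real {ω | X ω ≤ -y} := by
  have h1 : P {ω | X ω ≤ -y} = gaussianReal 0 1 (Set.Iic (-y)) :=
    hX.measure_eq (p := fun x => x ≤ -y) measurableSet_Iic
  have h2 : ENNReal.ofReal ((Real.sqrt (2 * Real.pi))⁻¹ * Real.exp (-((y + 1) ^ 2 / 2))) ≤
      gaussianReal 0 1 (Set.Iic (-y)) := by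
    calc _ = ∫⁻ _ in Set.Icc (-y - 1) (-y),
          ENNReal.ofReal ((Real.sqrt (2 * Real.pi))⁻¹ * Real.exp (-((y + 1) ^ 2 / 2))) := by
          rw [setLIntegral_const, Real.volume_Icc]
          simp
      _ ≤ ∫⁻ x in Set.Icc (-y - 1) (-y), gaussianPDF 0 1 x := by
          refine setLIntegral_mono' measurableSet_Icc fun x hx => ?_
          rw [gaussianPDF, gaussianPDFReal]
          refine ENNReal.ofReal_le_ofReal ?_
          simp only [NNReal.coe_one, mul_one, sub_zero]
          refine mul_le_mul_of_nonneg_left (Real.exp_le_exp.2 ?_) (by positivity)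
          rw [neg_div]
          have : x ^ 2 ≤ (y + 1) ^ 2 := sq_le_sq' (by linarith [hx.1]) (by linarith [hx.2])
          linarith
      _ = gaussianReal 0 1 (Set.Icc (-y - 1) (-y)) := (gaussianReal_apply 0 one_ne_zero _).symm
      _ ≤ _ := measure_mono Set.Icc_subset_Iic_self
  rw [Measure.real, h1]
  exact (ENNReal.ofReal_le_iff_le_toReal (measure_ne_top _ _)).1 h2

theorem memLp_two_of_hasLaw (hX : HasLaw X (gaussianReal 0 1) P) : MemLp X 2 P := by
  have h := memLp_id_gaussianReal (μ := 0) (v := 1) 2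
  rw [← hX.map_eq] at h
  exact h.comp_of_map hX.aemeasurable

variable [IsProbabilityMeasure P]

/-- The first Borel-Cantelli lemma, shifted so that the bound is needed only for large `N`. -/
theorem ae_eventually_notMem_of_summable {s : ℕ → Set Ω} {b : ℕ → ℝ} (hb : Summable b)
    (h : ∀ᶠ N in atTop, P.real (s N) ≤ b N) : ∀ᵐ ω ∂P, ∀ᶠ N in atTop, ω ∉ s N := by
  obtain ⟨M, hM⟩ := eventually_atTop.1 h
  have hsum : Summable fun N => P.real (s (N + M)) :=
    Summable.of_nonneg_of_le (fun _ => measureReal_nonneg) (fun N => hM (N + M) (by omega))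
      ((summable_nat_add_iff M).2 hb)
  have hne : ∑' N, P (s (N + M)) ≠ ⊤ := by
    have h1 : ∀ N, P (s (N + M)) = ENNReal.ofReal (P.real (s (N + M))) := fun N => by
      rw [ofReal_measureReal]
    simp only [h1]
    rw [← ENNReal.ofReal_tsum_of_nonneg (fun _ => measureReal_nonneg) hsum]
    exact ENNReal.ofReal_ne_top
  filter_upwards [ae_eventually_notMem hne] with ω hω
  obtain ⟨K, hK⟩ := eventually_atTop.1 hω
  refine eventually_atTop.2 ⟨K + M, fun N hN => ?_⟩
  have := hK (N - M) (by omega)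
  rwa [Nat.sub_add_cancel (by omega)] at this

/-- Chernoff's bound at the optimal exponent `-y`. -/
theorem gaussian_lower_tail_le (hX : HasLaw X (gaussianReal 0 1) P) {y : ℝ} (hy : 0 ≤ y) :
    P.real {ω | X ω ≤ -y} ≤ Real.exp (-(y ^ 2 / 2)) := by
  refine (measure_le_le_exp_mul_mgf (-y) (neg_nonpos.2 hy)
    (integrable_exp_of_hasLaw hX (-y))).trans (le_of_eq ?_)
  rw [mgf, mgf_of_hasLaw hX, ← Real.exp_add]
  ring_nf

variable {ι : Type*} [Fintype ι]

/-- Chebyshev's inequality for sums of independent variables. -/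
theorem chebyshev_sum {Y : ι → Ω → ℝ} (hY : ∀ i, MemLp (Y i) 2 P) (hindep : iIndepFun Y P)
    {c : ℝ} (hc : 0 < c) :
    P.real {ω | c ≤ |∑ i, Y i ω - ∑ i, ∫ ω, Y i ω ∂P|} ≤ (∑ i, variance (Y i) P) / c ^ 2 := by
  have hmem : MemLp (∑ i, Y i) 2 P := memLp_finsetSum' _ fun i _ => hY i
  have h := meas_ge_le_variance_div_sq hmem hc
  rw [IndepFun.variance_sum (fun i _ => hY i) fun i _ j _ hij => hindep.indepFun hij] at h
  have hE : ∫ ω, (∑ i, Y i) ω ∂P = ∑ i, ∫ ω, Y i ω ∂P := by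
    simp only [Finset.sum_apply]
    exact integral_finsetSum _ fun i _ => (hY i).integrable (by norm_num)
  rw [hE] at h
  simp only [Finset.sum_apply] at h
  refine ENNReal.toReal_le_of_le_ofReal ?_ h
  exact div_nonneg (Finset.sum_nonneg fun i _ => variance_nonneg _ _) (sq_nonneg c)

end Gaussian

/-! ### Almost sure asymptotics of the random energy model -/

section Asymptotics

variable {Ω : Type*} [MeasurableSpace Ω] {P : Measure Ω}
  {g : (N : ℕ) → Config N → Ω → ℝ}

theorem card_config (N : ℕ) : (Finset.univ : Finset (Config N)).card = 2 ^ N := by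
  simp [Fintype.card_pi]

theorem integral_remPartition (hlaw : ∀ N σ, HasLaw (g N σ) (gaussianReal 0 1) P) (N : ℕ) (β : ℝ) :
    Integrable (fun ω => remPartition β fun σ => g N σ ω) P ∧
      ∫ ω, remPartition β (fun σ => g N σ ω) ∂P = Real.exp (N * (β ^ 2 / 2)) := by
  have h : ∀ σ ω, Real.exp (-(β * potential (fun σ => g N σ ω) σ)) =
      Real.exp ((-(β * Real.sqrt N)) * g N σ ω) := by
    intro σ ω
    rw [potential]
    ring_nf
  simp only [remPartition, h]
  have hint : ∀ σ, Integrable (fun ω => Real.exp ((-(β * Real.sqrt N)) * g N σ ω)) P :=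
    fun σ => integrable_exp_of_hasLaw (hlaw N σ) _
  refine ⟨(integrable_finsetSum _ fun σ _ => hint σ).const_mul _, ?_⟩
  rw [integral_const_mul, integral_finsetSum _ fun σ _ => hint σ]
  simp only [fun σ => mgf_of_hasLaw (hlaw N σ) (-(β * Real.sqrt N)), Finset.sum_const, card_config,
    nsmul_eq_mul]
  push_cast
  rw [inv_mul_cancel_left₀ (by positivity), neg_sq, mul_pow, Real.sq_sqrt (Nat.cast_nonneg N)]
  ring_nf

variable [IsProbabilityMeasure P]

/-- Markov's inequality: exceeding the mean by the factor `exp (N η)` has probability at most `exp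
(-N η)`. -/
theorem eventually_remPartition_lt_annealed (hlaw : ∀ N σ, HasLaw (g N σ) (gaussianReal 0 1) P)
    (β : ℝ) {η : ℝ} (hη : 0 < η) :
    ∀ᵐ ω ∂P, ∀ᶠ N : ℕ in atTop,
      remPartition β (fun σ => g N σ ω) < Real.exp (N * (β ^ 2 / 2 + η)) := by
  have h := ae_eventually_notMem_of_summable (P := P)
    (s := fun N : ℕ => {ω | Real.exp (N * (β ^ 2 / 2 + η)) ≤ remPartition β fun σ => g N σ ω})
    (summable_exp_neg_mul hη) (Eventually.of_forall fun N => ?_)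
  · filter_upwards [h] with ω hω
    filter_upwards [hω] with N hN
    exact not_le.1 hN
  · obtain ⟨h1, h2⟩ := integral_remPartition hlaw N β
    have h3 := mul_meas_ge_le_integral_of_nonneg (ae_of_all _ fun ω => (remPartition_pos β _).le) h1
      (Real.exp (N * (β ^ 2 / 2 + η)))
    rw [h2, mul_comm, ← le_div_iff₀ (Real.exp_pos _), ← Real.exp_sub] at h3
    refine h3.trans (le_of_eq ?_)
    ring_nf

theorem betaC_pos : 0 < betaC := Real.sqrt_pos.2 (by have := Real.log_pos one_lt_two; linarith)

theorem betaC_sq : betaC ^ 2 = 2 * Real.log 2 :=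
  Real.sq_sqrt (by have := Real.log_pos one_lt_two; linarith)

/-- The sums `∑ x^r`, `r ≥ 1`, are dominated by the powers of `∑ x`. -/
theorem sum_rpow_le_rpow_sum {ι : Type*} (s : Finset ι) {x : ι → ℝ} (hx : ∀ i ∈ s, 0 < x i) {r : ℝ}
    (hr : 1 ≤ r) : ∑ i ∈ s, x i ^ r ≤ (∑ i ∈ s, x i) ^ r := by
  rcases s.eq_empty_or_nonempty with rfl | hs
  · simp [Real.zero_rpow (by linarith : r ≠ 0)]
  set S := ∑ i ∈ s, x i
  have hS : 0 < S := Finset.sum_pos hx hs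
  have hr' : ∀ y : ℝ, 0 < y → y ^ r = y * y ^ (r - 1) := fun y hy => by
    rw [← Real.rpow_one_add' hy.le (by linarith)]; ring_nf
  rw [hr' S hS, Finset.sum_mul]
  refine Finset.sum_le_sum fun i hi => ?_
  rw [hr' _ (hx i hi)]
  refine mul_le_mul_of_nonneg_left (Real.rpow_le_rpow (hx i hi).le ?_ (by linarith)) (hx i hi).le
  exact Finset.single_le_sum (fun j hj => (hx j hj).le) hi

/-- Comparison of the partition function in the frozen phase with that at the freezing point. -/
theorem remPartition_le_of_critical {N : ℕ} {β η : ℝ} (hβ : betaC ≤ β) (g : Config N → ℝ)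
    (h : remPartition betaC g ≤ Real.exp (N * (betaC ^ 2 / 2 + η))) :
    remPartition β g ≤
      Real.exp (N * (betaC ^ 2 / 2 + (β - betaC) * betaC + β / betaC * η)) := by
  have hc := betaC_pos
  have h2 : (2 : ℝ) ^ N = Real.exp (N * (betaC ^ 2 / 2)) := by
    rw [betaC_sq, mul_div_cancel_left₀ _ (two_ne_zero), Real.exp_nat_mul, Real.exp_log two_pos]
  have h1 : ∑ σ, Real.exp (-(betaC * potential g σ)) ≤
      Real.exp (N * (betaC ^ 2 + η)) := by
    rw [remPartition, inv_mul_le_iff₀ (by positivity), h2, ← Real.exp_add] at h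
    refine h.trans (le_of_eq ?_)
    ring_nf
  have hsum : ∑ σ, Real.exp (-(β * potential g σ)) ≤
      Real.exp (N * (betaC ^ 2 + η)) ^ (β / betaC) := by
    refine le_trans (le_of_eq ?_) ((sum_rpow_le_rpow_sum Finset.univ
      (x := fun σ => Real.exp (-(betaC * potential g σ))) (fun _ _ => Real.exp_pos _)
      ((one_le_div hc).2 hβ)).trans (Real.rpow_le_rpow (Finset.sum_nonneg fun _ _ =>
        (Real.exp_pos _).le) h1 (div_nonneg (hc.le.trans hβ) hc.le)))
    refine Finset.sum_congr rfl fun σ _ => ?_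
    rw [← Real.exp_mul]
    congr 1
    field_simp
  rw [remPartition, inv_mul_le_iff₀ (by positivity), h2, ← Real.exp_add]
  refine hsum.trans (le_of_eq ?_)
  rw [← Real.exp_mul]
  congr 1
  field_simp
  ring

theorem eventually_remPartition_le (hlaw : ∀ N σ, HasLaw (g N σ) (gaussianReal 0 1) P)
    (β : ℝ) {η : ℝ} (hη : 0 < η) :
    ∀ᵐ ω ∂P, ∀ᶠ N : ℕ in atTop,
      remPartition β (fun σ => g N σ ω) ≤ Real.exp (N * (pREM β + η)) := by
  rcases le_or_gt β betaC with hβ | hβ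
  · filter_upwards [eventually_remPartition_lt_annealed hlaw β hη] with ω hω
    filter_upwards [hω] with N hN
    rw [pREM, if_pos hβ]
    exact hN.le
  · have hc := betaC_pos
    have hβ0 := hc.trans hβ
    -- The comparison with `β_c` multiplies the error by `β / β_c`, which this choice compensates.
    filter_upwards [eventually_remPartition_lt_annealed hlaw betaC
      (η := betaC / β * η) (by positivity)] with ω hω
    filter_upwards [hω] with N hN
    refine (remPartition_le_of_critical hβ.le _ hN.le).trans (le_of_eq ?_)
    rw [pREM, if_neg (not_le.2 hβ)]
    congr 2
    field_simp

/-- Lower bound by the energy level `-x N`, from the concentration of the number of configurations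
below it. -/
theorem eventually_remPartition_ge_of_lt (hlaw : ∀ N σ, HasLaw (g N σ) (gaussianReal 0 1) P)
    (hindep : ∀ N, iIndepFun (g N) P) {β x : ℝ} (hβ : 0 ≤ β) (hx : 0 ≤ x)
    {η : ℝ} (hη : 0 < η) (hη' : η < Real.log 2 - x ^ 2 / 2) :
    ∀ᵐ ω ∂P, ∀ᶠ N : ℕ in atTop,
      Real.exp (N * (β * x - x ^ 2 / 2 - η)) ≤ remPartition β fun σ => g N σ ω := by
  -- The event `U ≤ -x N` in terms of `g`; `Y` is its indicator and `q` its probability.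
  set y : ℕ → ℝ := fun N => x * Real.sqrt N with hy
  have hy0 : ∀ N, 0 ≤ y N := fun N => by positivity
  set f : ℕ → ℝ → ℝ := fun N => (Set.Iic (-(y N))).indicator 1 with hf
  have hfm : ∀ N, Measurable (f N) := fun N => measurable_one.indicator measurableSet_Iic
  set Y : (N : ℕ) → Config N → Ω → ℝ := fun N σ ω => f N (g N σ ω) with hY
  set q : ℕ → ℝ := fun N => (gaussianReal 0 1).real (Set.Iic (-(y N))) with hq
  have hYm : ∀ N σ, AEMeasurable (Y N σ) P := fun N σ =>
    (hfm N).comp_aemeasurable (hlaw N σ).aemeasurable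
  have hY01 : ∀ N σ ω, Y N σ ω = 0 ∨ Y N σ ω = 1 := fun N σ ω => by
    simp only [hY, hf, Set.indicator_apply]; split_ifs <;> simp
  have hYL : ∀ N σ, MemLp (Y N σ) 2 P := fun N σ =>
    MemLp.of_bound (hYm N σ).aestronglyMeasurable 1 (ae_of_all _ fun ω => by
      rcases hY01 N σ ω with h | h <;> simp [h])
  have hYE : ∀ N σ, ∫ ω, Y N σ ω ∂P = q N := fun N σ => by
    have h1 := (hlaw N σ).integral_comp (f := f N) (hfm N).aestronglyMeasurable
    have h2 : ∫ z, f N z ∂(gaussianReal 0 1) = q N := integral_indicator_one measurableSet_Iic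
    rw [← h2, ← h1]
    rfl
  have hYV : ∀ N σ, variance (Y N σ) P ≤ q N := fun N σ => by
    refine (variance_le_expectation_sq (hYm N σ).aestronglyMeasurable).trans (le_of_eq ?_)
    rw [← hYE N σ]
    congr 1
    funext ω
    rcases hY01 N σ ω with h | h <;> simp [h]
  have hYI : ∀ N, iIndepFun (Y N) P := fun N => (hindep N).comp (fun _ => f N) fun _ => hfm N
  -- The factor `4` offsets the squared `1 / 2` in Chebyshev's bound for a deviation of half the
  -- mean `2 ^ N * q N`.
  have hqlow : ∀ᶠ N : ℕ in atTop, 4 * Real.exp (-(N * (x ^ 2 / 2 + η))) ≤ q N := by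
    filter_upwards [eventually_add_mul_sqrt_le
      (Real.log 4 + Real.log (Real.sqrt (2 * Real.pi)) + 1 / 2) x hη] with N hN
    have hpi : 0 < Real.sqrt (2 * Real.pi) := Real.sqrt_pos.2 (by positivity)
    have hq1 : (Real.sqrt (2 * Real.pi))⁻¹ * Real.exp (-((y N + 1) ^ 2 / 2)) ≤ q N := by
      have := le_gaussian_lower_tail (hlaw N 1) (hy0 N)
      have h' := (hlaw N 1).measureReal_eq (p := fun z => z ≤ -(y N)) measurableSet_Iic
      rw [h'] at this
      exact this
    refine le_trans ?_ hq1
    have e4 : (4 : ℝ) = Real.exp (Real.log 4) := (Real.exp_log (by norm_num)).symm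
    have epi : (Real.sqrt (2 * Real.pi))⁻¹ = Real.exp (-Real.log (Real.sqrt (2 * Real.pi))) := by
      rw [Real.exp_neg, Real.exp_log hpi]
    rw [epi, ← Real.exp_add]
    nth_rewrite 1 [e4]
    rw [← Real.exp_add, Real.exp_le_exp]
    have hs : y N ^ 2 = x ^ 2 * N := by
      rw [hy]; simp only; rw [mul_pow, Real.sq_sqrt (Nat.cast_nonneg N)]
    have : (y N + 1) ^ 2 / 2 = x ^ 2 * N / 2 + x * Real.sqrt N + 1 / 2 := by
      rw [add_sq, hs]; simp only [hy]; ring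
    linarith
  have hqpos : ∀ᶠ N : ℕ in atTop, 0 < q N :=
    hqlow.mono fun N hN => lt_of_lt_of_le (by positivity) hN
  have hbad := ae_eventually_notMem_of_summable (P := P)
    (s := fun N : ℕ => {ω | (2 : ℝ) ^ N * q N / 2 ≤
      |∑ σ, Y N σ ω - ∑ σ : Config N, ∫ ω, Y N σ ω ∂P|})
    (summable_exp_neg_mul (sub_pos.2 hη')) (by
      filter_upwards [hqlow, hqpos] with N hN hN0
      have hc : 0 < (2 : ℝ) ^ N * q N / 2 := by positivity
      refine (chebyshev_sum (hYL N) (hYI N) hc).trans ?_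
      have hv : ∑ σ, variance (Y N σ) P ≤ 2 ^ N * q N := by
        refine (Finset.sum_le_sum fun σ _ => hYV N σ).trans (le_of_eq ?_)
        rw [Finset.sum_const, card_config, nsmul_eq_mul]
        push_cast; rfl
      rw [div_le_iff₀ (by positivity)]
      have h2 : (2 : ℝ) ^ N = Real.exp (N * Real.log 2) := by
        rw [Real.exp_nat_mul, Real.exp_log two_pos]
      have hkey : 4 ≤ Real.exp (-(N * (Real.log 2 - x ^ 2 / 2 - η))) * (2 ^ N * q N) := by
        calc (4 : ℝ) = Real.exp (-(N * (Real.log 2 - x ^ 2 / 2 - η))) *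
              (2 ^ N * (4 * Real.exp (-(N * (x ^ 2 / 2 + η))))) := by
              rw [h2, mul_left_comm _ (4 : ℝ), mul_left_comm _ (4 : ℝ), ← Real.exp_add,
                ← Real.exp_add]
              ring_nf
              simp
          _ ≤ _ := by gcongr
      have hpos : 0 < (2 : ℝ) ^ N * q N := by positivity
      calc _ ≤ 2 ^ N * q N := hv
        _ ≤ 2 ^ N * q N * ((Real.exp (-(N * (Real.log 2 - x ^ 2 / 2 - η))) * (2 ^ N * q N)) / 4) :=
            le_mul_of_one_le_right hpos.le (by linarith)
        _ = _ := by ring)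
  filter_upwards [hbad] with ω hω
  filter_upwards [hω, hqlow, hqpos] with N hN hN1 hN0
  have hcount : (2 : ℝ) ^ N * q N / 2 ≤ ∑ σ, Y N σ ω := by
    simp only [not_le, hYE, Finset.sum_const, card_config, nsmul_eq_mul] at hN
    push_cast at hN
    linarith [(abs_lt.1 hN).1]
  have hpt : ∀ σ, Real.exp (N * (β * x)) * Y N σ ω ≤
      Real.exp (-(β * potential (fun σ => g N σ ω) σ)) := by
    intro σ
    simp only [hY, hf, Set.indicator_apply]
    split_ifs with h
    · rw [Pi.one_apply, mul_one, Real.exp_le_exp, potential]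
      have h' : g N σ ω ≤ -(x * Real.sqrt N) := h
      have h3 := mul_le_mul_of_nonneg_left h' (Real.sqrt_nonneg N)
      have h4 : Real.sqrt N * -(x * Real.sqrt N) = -(x * N) := by
        have := Real.mul_self_sqrt (Nat.cast_nonneg (α := ℝ) N)
        linear_combination (-x) * this
      rw [h4] at h3
      have := mul_le_mul_of_nonneg_left h3 hβ
      linarith
    · rw [mul_zero]; exact (Real.exp_pos _).le
  have hsum : Real.exp (N * (β * x)) * ∑ σ, Y N σ ω ≤
      ∑ σ, Real.exp (-(β * potential (fun σ => g N σ ω) σ)) := by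
    rw [Finset.mul_sum]
    exact Finset.sum_le_sum fun σ _ => hpt σ
  rw [remPartition]
  calc Real.exp (N * (β * x - x ^ 2 / 2 - η))
      = Real.exp (N * (β * x)) * Real.exp (-(N * (x ^ 2 / 2 + η))) := by
        rw [← Real.exp_add]; ring_nf
    _ ≤ Real.exp (N * (β * x)) * (q N / 2) := by
        have := Real.exp_pos (-(N * (x ^ 2 / 2 + η)))
        gcongr
        linarith
    _ = ((2 : ℝ) ^ N)⁻¹ * (Real.exp (N * (β * x)) * (2 ^ N * q N / 2)) := by
        field_simp
    _ ≤ _ := by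
        refine mul_le_mul_of_nonneg_left (le_trans ?_ hsum) (by positivity)
        gcongr

theorem eventually_remPartition_ge (hlaw : ∀ N σ, HasLaw (g N σ) (gaussianReal 0 1) P)
    (hindep : ∀ N, iIndepFun (g N) P) {β : ℝ} (hβ : 0 ≤ β) {η : ℝ} (hη : 0 < η) :
    ∀ᵐ ω ∂P, ∀ᶠ N : ℕ in atTop,
      Real.exp (N * (pREM β - η)) ≤ remPartition β fun σ => g N σ ω := by
  have hc := betaC_pos
  -- The best level on `[0, β_c]` is `min β β_c`. At `β_c` the expected number of levels no longer
  -- grows exponentially, so in the frozen phase `x` is taken slightly below.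
  obtain ⟨x, hx0, hxc, hx⟩ : ∃ x, 0 ≤ x ∧ x < betaC ∧ pREM β - η / 2 ≤ β * x - x ^ 2 / 2 := by
    rcases lt_or_ge β betaC with h | h
    · refine ⟨β, hβ, h, ?_⟩
      rw [pREM, if_pos h.le]
      nlinarith
    · have hp : pREM β = β * betaC - betaC ^ 2 / 2 := by
        rw [pREM]
        split_ifs with h'
        · rw [le_antisymm h' h]; ring
        · ring
      have hcont : Tendsto (fun x : ℝ => β * x - x ^ 2 / 2) (𝓝[<] betaC)
          (𝓝 (β * betaC - betaC ^ 2 / 2)) :=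
        ((by fun_prop : Continuous fun x : ℝ => β * x - x ^ 2 / 2).tendsto betaC).mono_left
          nhdsWithin_le_nhds
      rw [← hp] at hcont
      have h1 := hcont.eventually_const_le (show pREM β - η / 2 < pREM β by linarith)
      have h2 : ∀ᶠ x in 𝓝[<] betaC, x ∈ Set.Ioo 0 betaC := Ioo_mem_nhdsLT hc
      obtain ⟨x, hx1, hx2⟩ := (h1.and h2).exists
      exact ⟨x, hx2.1.le, hx2.2, hx1⟩
  have hgap : 0 < Real.log 2 - x ^ 2 / 2 := by
    have := betaC_sq
    nlinarith
  set θ := min (η / 2) ((Real.log 2 - x ^ 2 / 2) / 2) with hθ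
  have hθ0 : 0 < θ := lt_min (by linarith) (by linarith)
  have hθ1 : θ ≤ η / 2 := min_le_left _ _
  have hθ2 : θ ≤ (Real.log 2 - x ^ 2 / 2) / 2 := min_le_right _ _
  filter_upwards [eventually_remPartition_ge_of_lt hlaw hindep hβ hx0 hθ0
    (by linarith)] with ω hω
  filter_upwards [hω] with N hN
  refine le_trans (Real.exp_le_exp.2 ?_) hN
  exact mul_le_mul_of_nonneg_left (by linarith) (Nat.cast_nonneg N)

theorem eventually_abs_average_potential_le
    (hlaw : ∀ N σ, HasLaw (g N σ) (gaussianReal 0 1) P)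
    (hindep : ∀ N, iIndepFun (g N) P) {η : ℝ} (hη : 0 < η) :
    ∀ᵐ ω ∂P, ∀ᶠ N : ℕ in atTop,
      |((2 : ℝ) ^ N)⁻¹ * ∑ σ, potential (fun σ => g N σ ω) σ| ≤ N * η := by
  have hmean : ∀ N σ, ∫ ω, g N σ ω ∂P = 0 := fun N σ => by
    rw [(hlaw N σ).integral_eq, integral_id_gaussianReal]
  have hvar : ∀ N σ, variance (g N σ) P = 1 := fun N σ => by
    rw [(hlaw N σ).variance_eq, variance_id_gaussianReal]; rfl
  -- Chebyshev's inequality gives `2 ^ N / (η ^ 2 * N * 4 ^ N)`; the factor `1 / N` is dropped.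
  have hsummable : Summable fun N : ℕ => (η ^ 2)⁻¹ * (1 / 2 : ℝ) ^ N :=
    (summable_geometric_of_lt_one (by norm_num) (by norm_num)).mul_left _
  have hbad := ae_eventually_notMem_of_summable (P := P)
    (s := fun N : ℕ => {ω | η * Real.sqrt N * 2 ^ N ≤
      |∑ σ, g N σ ω - ∑ σ : Config N, ∫ ω, g N σ ω ∂P|})
    hsummable (by
      filter_upwards [eventually_ge_atTop 1] with N hN
      have hN' : (1 : ℝ) ≤ N := by exact_mod_cast hN
      have hs : 0 < Real.sqrt N := Real.sqrt_pos.2 (by linarith)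
      refine (chebyshev_sum (fun σ => memLp_two_of_hasLaw (hlaw N σ)) (hindep N)
        (by positivity)).trans ?_
      simp only [hvar, Finset.sum_const, card_config, nsmul_eq_mul, mul_one]
      rw [mul_pow, mul_pow, Real.sq_sqrt (Nat.cast_nonneg N), div_le_iff₀ (by positivity)]
      push_cast
      have : (η ^ 2)⁻¹ * (1 / 2 : ℝ) ^ N * (η ^ 2 * N * (2 ^ N) ^ 2) = N * 2 ^ N := by
        rw [one_div, inv_pow]
        field_simp
      rw [this]
      exact le_mul_of_one_le_left (by positivity) hN')
  filter_upwards [hbad] with ω hω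
  filter_upwards [hω] with N hN
  simp only [not_le, hmean, Finset.sum_const_zero, sub_zero] at hN
  simp only [potential, ← Finset.mul_sum]
  rw [abs_mul, abs_mul, abs_of_pos (by positivity : 0 < ((2 : ℝ) ^ N)⁻¹),
    abs_of_nonneg (Real.sqrt_nonneg _), inv_mul_le_iff₀ (by positivity)]
  refine (mul_le_mul_of_nonneg_left hN.le (Real.sqrt_nonneg _)).trans (le_of_eq ?_)
  have := Real.mul_self_sqrt (Nat.cast_nonneg (α := ℝ) N)
  linear_combination (η * 2 ^ N) * this

/-- No configuration has a positive fraction of neighbours with an extensively low potential. -/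
theorem eventually_card_deep_neighbours_le
    (hlaw : ∀ N σ, HasLaw (g N σ) (gaussianReal 0 1) P)
    (hindep : ∀ N, iIndepFun (g N) P) {ε δ : ℝ} (hε : 0 < ε) (hδ : 0 < δ) :
    ∀ᵐ ω ∂P, ∀ᶠ N : ℕ in atTop, ∀ σ : Config N,
      ((Finset.univ.filter fun j => potential (fun σ => g N σ ω) (flip j σ) < -(ε * N)).card : ℝ) ≤
        δ ^ 2 * N := by
  have hsingle : ∀ (N : ℕ) (σ : Config N) (S : Finset (Fin N)), δ ^ 2 * N ≤ S.card →
      P.real {ω | ∀ j ∈ S, g N (flip j σ) ω ≤ -(ε * Real.sqrt N)} ≤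
        Real.exp (-(ε ^ 2 * N / 2) * (δ ^ 2 * N)) := by
    intro N σ S hS
    -- The neighbours of `σ` are distinct, so their variables are independent.
    have hind := (hindep N).precomp (flip_injective_left σ)
    have hm := hind.measure_inter_preimage_eq_mul S
      (sets := fun _ => Set.Iic (-(ε * Real.sqrt N))) fun _ _ => measurableSet_Iic
    have hset : {ω | ∀ j ∈ S, g N (flip j σ) ω ≤ -(ε * Real.sqrt N)} =
        ⋂ j ∈ S, (fun ω => g N (flip j σ) ω) ⁻¹' Set.Iic (-(ε * Real.sqrt N)) := by
      ext ω; simp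
    rw [hset, Measure.real, hm, ENNReal.toReal_prod]
    calc _ ≤ ∏ _j ∈ S, Real.exp (-(ε ^ 2 * N / 2)) := by
          refine Finset.prod_le_prod (fun _ _ => ENNReal.toReal_nonneg) fun j _ => ?_
          have := gaussian_lower_tail_le (hlaw N (flip j σ))
            (y := ε * Real.sqrt N) (by positivity)
          rw [mul_pow, Real.sq_sqrt (Nat.cast_nonneg N)] at this
          exact this
      _ = Real.exp (-(ε ^ 2 * N / 2) * S.card) := by
          rw [Finset.prod_const, ← Real.exp_nat_mul, mul_comm]
      _ ≤ _ := by
          refine Real.exp_le_exp.2 (mul_le_mul_of_nonpos_left hS ?_)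
          rw [neg_nonpos]
          positivity
  have hbad := ae_eventually_notMem_of_summable (P := P)
    (s := fun N : ℕ => ⋃ p : Config N × {S : Finset (Fin N) // δ ^ 2 * N ≤ S.card},
      {ω | ∀ j ∈ p.2.1, g N (flip j p.1) ω ≤ -(ε * Real.sqrt N)})
    (summable_exp_neg_mul one_pos) (by
      have hc : 0 < ε ^ 2 * δ ^ 2 / 2 := by positivity
      -- From this threshold on, `4 ^ N * exp (-N ^ 2 * (ε ^ 2 * δ ^ 2 / 2)) ≤ exp (-N)`.
      filter_upwards [(tendsto_natCast_atTop_atTop (R := ℝ)).eventually_ge_atTop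
        ((2 * Real.log 2 + 1) / (ε ^ 2 * δ ^ 2 / 2))] with N hN
      rw [div_le_iff₀ hc] at hN
      refine (measureReal_iUnion_fintype_le _).trans ?_
      refine (Finset.sum_le_sum fun p _ => hsingle N p.1 p.2.1 p.2.2).trans ?_
      rw [Finset.sum_const, nsmul_eq_mul, Finset.card_univ, Fintype.card_prod]
      have hcard : ((Fintype.card (Config N) *
          Fintype.card {S : Finset (Fin N) // δ ^ 2 * N ≤ S.card} : ℕ) : ℝ) ≤
          Real.exp (N * (2 * Real.log 2)) := by
        have h1 : Fintype.card (Config N) = 2 ^ N := card_config N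
        have h2 : Fintype.card {S : Finset (Fin N) // δ ^ 2 * N ≤ S.card} ≤ 2 ^ N := by
          refine (Fintype.card_subtype_le _).trans ?_
          simp
        have h3 : Real.exp (N * (2 * Real.log 2)) = (2 : ℝ) ^ N * 2 ^ N := by
          rw [← mul_pow, Real.exp_nat_mul, two_mul, Real.exp_add, Real.exp_log two_pos]
        rw [h3, h1]
        push_cast
        refine mul_le_mul_of_nonneg_left ?_ (by positivity)
        exact_mod_cast h2
      refine (mul_le_mul_of_nonneg_right hcard (Real.exp_pos _).le).trans ?_
      rw [← Real.exp_add, Real.exp_le_exp]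
      have := mul_le_mul_of_nonneg_left hN (Nat.cast_nonneg (α := ℝ) N)
      linarith)
  filter_upwards [hbad] with ω hω
  filter_upwards [hω, eventually_ge_atTop 1] with N hN hN1 σ
  by_contra! hlt
  refine hN (Set.mem_iUnion.2 ⟨(σ, ⟨_, hlt.le⟩), fun j hj => ?_⟩)
  have hj' := (Finset.mem_filter.1 hj).2
  have hN' : (1 : ℝ) ≤ N := by exact_mod_cast hN1
  have hs : 0 < Real.sqrt N := Real.sqrt_pos.2 (by linarith)
  have h2 := Real.mul_self_sqrt (Nat.cast_nonneg (α := ℝ) N)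
  rw [potential] at hj'
  by_contra! hgt
  have := mul_lt_mul_of_pos_left hgt hs
  nlinarith

end Asymptotics

/-! ### Convergence of the pressure -/

section Limit

theorem exp_mul_pPAR (N : ℕ) (x : ℝ) : Real.exp (N * pPAR x) = Real.cosh x ^ N := by
  rw [pPAR, Real.exp_nat_mul, Real.exp_log (Real.cosh_pos x)]

variable {Ω : Type*} [MeasurableSpace Ω] {P : Measure Ω} [IsProbabilityMeasure P]
  {g : (N : ℕ) → Config N → Ω → ℝ}

theorem eventually_le_partitionFunction (hlaw : ∀ N σ, HasLaw (g N σ) (gaussianReal 0 1) P)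
    (hindep : ∀ N, iIndepFun (g N) P) {β Γ : ℝ} (hβ : 0 ≤ β) {η : ℝ} (hη : 0 < η) :
    ∀ᵐ ω ∂P, ∀ᶠ N : ℕ in atTop, Real.exp (N * (max (pREM β) (pPAR (β * Γ)) - η)) ≤
      partitionFunction β Γ fun σ => g N σ ω := by
  rcases le_total (pPAR (β * Γ)) (pREM β) with h | h
  · rw [max_eq_left h]
    filter_upwards [eventually_remPartition_ge hlaw hindep hβ hη] with ω hω
    filter_upwards [hω] with N hN
    exact hN.trans (remPartition_le_partitionFunction β Γ _)
  · rw [max_eq_right h]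
    filter_upwards [eventually_abs_average_potential_le hlaw hindep
      (η := η / (β + 1)) (by positivity)] with ω hω
    filter_upwards [hω] with N hN
    refine le_trans ?_ (cosh_pow_mul_exp_le_partitionFunction β Γ _)
    rw [← exp_mul_pPAR, ← Real.exp_add, Real.exp_le_exp]
    have h1 := mul_le_mul_of_nonneg_left ((le_abs_self _).trans hN) hβ
    have h2 : β * (N * (η / (β + 1))) ≤ N * η := by
      have : β * (η / (β + 1)) ≤ η := by
        rw [← mul_div_assoc, div_le_iff₀ (by positivity)]
        nlinarith
      have := mul_le_mul_of_nonneg_left this (Nat.cast_nonneg (α := ℝ) N)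
      linarith
    linarith

theorem eventually_partitionFunction_le (hlaw : ∀ N σ, HasLaw (g N σ) (gaussianReal 0 1) P)
    (hindep : ∀ N, iIndepFun (g N) P) {β Γ : ℝ} (hβ : 0 ≤ β) (hΓ : 0 ≤ Γ) {η : ℝ} (hη : 0 < η) :
    ∀ᵐ ω ∂P, ∀ᶠ N : ℕ in atTop, partitionFunction β Γ (fun σ => g N σ ω) ≤
      Real.exp (N * (max (pREM β) (pPAR (β * Γ)) + η)) := by
  have hβΓ : 0 ≤ β * Γ := mul_nonneg hβ hΓ
  set m := max (pREM β) (pPAR (β * Γ)) with hm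
  -- The budget `η` is split into quarters: for `ε`, for `δ`, for the REM fluctuation, and for the
  -- `log 2` from adding two terms. The `+ 1` in the denominators of `ε` and `δ` covers `β = 0` and
  -- `Γ = 0`.
  set ε := η / (4 * (β + 1)) with hε
  set δ := η / (8 * (β * Γ + 1)) with hδ
  have hε0 : 0 < ε := by positivity
  have hδ0 : 0 < δ := by positivity
  have hε1 : β * ε ≤ η / 4 := by
    rw [hε, ← mul_div_assoc, div_le_iff₀ (by positivity)]
    nlinarith
  have hδ1 : 2 * (β * Γ) * δ ≤ η / 4 := by
    rw [hδ, ← mul_div_assoc, div_le_iff₀ (by positivity)]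
    nlinarith
  filter_upwards [eventually_card_deep_neighbours_le hlaw hindep hε0 hδ0,
    eventually_remPartition_le hlaw β (show 0 < η / 4 by linarith)] with ω h1 h2
  filter_upwards [h1, h2, eventually_add_mul_sqrt_le (Real.log 2) 0
    (show 0 < η / 4 by linarith)] with N hN1 hN2 hN3
  refine (partitionFunction_le hβ hΓ hε0.le hδ0 _ hN1).trans ?_
  have hN0 : (0 : ℝ) ≤ N := Nat.cast_nonneg N
  have e1 : Real.cosh (β * Γ) ^ N ≤ Real.exp (N * (m + η / 4)) := by
    rw [← exp_mul_pPAR, Real.exp_le_exp]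
    exact mul_le_mul_of_nonneg_left (by linarith [le_max_right (pREM β) (pPAR (β * Γ))]) hN0
  have e2 : remPartition β (fun σ => g N σ ω) ≤ Real.exp (N * (m + η / 4)) := by
    refine hN2.trans (Real.exp_le_exp.2 (mul_le_mul_of_nonneg_left ?_ hN0))
    linarith [le_max_left (pREM β) (pPAR (β * Γ))]
  calc _ ≤ Real.exp (N * (η / 4 + η / 4)) *
        (Real.exp (N * (m + η / 4)) + Real.exp (N * (m + η / 4))) := by
        have := remPartition_pos β fun σ => g N σ ω
        have hcosh := pow_pos (Real.cosh_pos (β * Γ)) N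
        gcongr
    _ = Real.exp (N * (η / 4 + η / 4) + Real.log 2 + N * (m + η / 4)) := by
        rw [Real.exp_add, Real.exp_add, Real.exp_log two_pos]; ring
    _ ≤ _ := Real.exp_le_exp.2 (by linarith)

theorem abs_inv_mul_log_sub_le {N : ℕ} (hN : 1 ≤ N) {z m η : ℝ} (h1 : Real.exp (N * (m - η)) ≤ z)
    (h2 : z ≤ Real.exp (N * (m + η))) : |(N : ℝ)⁻¹ * Real.log z - m| ≤ η := by
  have hN' : (0 : ℝ) < N := by exact_mod_cast hN
  have hz : 0 < z := (Real.exp_pos _).trans_le h1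
  have h3 := (Real.le_log_iff_exp_le hz).2 h1
  have h4 := (Real.log_le_iff_le_exp hz).2 h2
  rw [← le_inv_mul_iff₀ hN'] at h3
  rw [← inv_mul_le_iff₀ hN'] at h4
  exact abs_le.2 ⟨by linarith, by linarith⟩

/-- Goldschmidt's formula. -/
theorem ae_tendsto_pressure (hlaw : ∀ N σ, HasLaw (g N σ) (gaussianReal 0 1) P)
    (hindep : ∀ N, iIndepFun (g N) P) {β Γ : ℝ} (hβ : 0 ≤ β) (hΓ : 0 ≤ Γ) :
    ∀ᵐ ω ∂P, Tendsto (fun N : ℕ => pressure β Γ (fun σ => g N σ ω)) atTop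
      (𝓝 (max (pREM β) (pPAR (β * Γ)))) := by
  -- The null set depends on `η`, so only the countably many values `1 / (k + 1)` are used.
  have hlow := ae_all_iff.2 fun k : ℕ =>
    eventually_le_partitionFunction (Γ := Γ) hlaw hindep hβ (η := 1 / ((k : ℝ) + 1)) (by positivity)
  have hupp := ae_all_iff.2 fun k : ℕ =>
    eventually_partitionFunction_le hlaw hindep hβ hΓ (η := 1 / ((k : ℝ) + 1)) (by positivity)
  filter_upwards [hlow, hupp] with ω h1 h2
  rw [Metric.tendsto_atTop']
  intro e he
  obtain ⟨k, hk⟩ := exists_nat_one_div_lt he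
  obtain ⟨M, hM⟩ := eventually_atTop.1 ((h1 k).and ((h2 k).and (eventually_ge_atTop 1)))
  refine ⟨M, fun N hN => ?_⟩
  obtain ⟨a, b, c⟩ := hM N hN.le
  rw [Real.dist_eq]
  exact (abs_inv_mul_log_sub_le c a b).trans_lt hk

end Limit

/-! ### The first-order and the freezing transition -/

section PhaseTransitions

theorem pREM_pos {β : ℝ} (hβ : 0 < β) : 0 < pREM β := by
  have hc := betaC_pos
  rw [pREM]
  split_ifs with h
  · positivity
  · have := mul_pos (sub_pos.2 (not_le.1 h)) hc
    positivity

theorem one_lt_exp_pREM {β : ℝ} (hβ : 0 < β) : 1 < Real.exp (pREM β) :=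
  Real.one_lt_exp_iff.2 (pREM_pos hβ)

theorem gammaC_pos {β : ℝ} (hβ : 0 < β) : 0 < gammaC β :=
  mul_pos (inv_pos.2 hβ) (Real.arcosh_pos (one_lt_exp_pREM hβ))

/-- The two phases coexist at the critical field; with the monotonicity of `ln cosh` on `[0, ∞)`
this decides every comparison between them. -/
theorem pPAR_mul_gammaC {β : ℝ} (hβ : 0 < β) : pPAR (β * gammaC β) = pREM β := by
  rw [gammaC, mul_inv_cancel_left₀ hβ.ne', pPAR, Real.cosh_arcosh (one_lt_exp_pREM hβ).le,
    Real.log_exp]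

theorem pPAR_lt_pPAR {x y : ℝ} (hx : 0 ≤ x) (hy : 0 ≤ y) : pPAR x < pPAR y ↔ x < y := by
  rw [pPAR, pPAR, Real.log_lt_log_iff (Real.cosh_pos x) (Real.cosh_pos y), Real.cosh_lt_cosh,
    abs_of_nonneg hx, abs_of_nonneg hy]

theorem pPAR_lt_pREM_iff {β Γ : ℝ} (hβ : 0 < β) (hΓ : 0 ≤ Γ) :
    pPAR (β * Γ) < pREM β ↔ Γ < gammaC β := by
  rw [← pPAR_mul_gammaC hβ, pPAR_lt_pPAR (by positivity) (by have := gammaC_pos hβ; positivity),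
    mul_lt_mul_iff_right₀ hβ]

theorem pREM_lt_pPAR_iff {β Γ : ℝ} (hβ : 0 < β) (hΓ : 0 ≤ Γ) :
    pREM β < pPAR (β * Γ) ↔ gammaC β < Γ := by
  rw [← pPAR_mul_gammaC hβ, pPAR_lt_pPAR (by have := gammaC_pos hβ; positivity) (by positivity),
    mul_lt_mul_iff_right₀ hβ]

theorem hasDerivAt_pPAR (x : ℝ) : HasDerivAt pPAR (Real.tanh x) x := by
  rw [Real.tanh_eq_sinh_div_cosh]
  exact (Real.hasDerivAt_cosh x).log (Real.cosh_pos x).ne'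

theorem hasDerivWithinAt_pQREM_left {β : ℝ} (hβ : 0 < β) :
    HasDerivWithinAt (fun Γ => pQREM β Γ) 0 (Set.Iic (gammaC β)) (gammaC β) := by
  have hG := gammaC_pos hβ
  refine (hasDerivWithinAt_const (gammaC β) _ (pREM β)).congr_of_eventuallyEq ?_ ?_
  -- The comparison is available only for `Γ ≥ 0`, hence the restriction to a neighbourhood of
  -- `gammaC β > 0`.
  · filter_upwards [self_mem_nhdsWithin, mem_nhdsWithin_of_mem_nhds (lt_mem_nhds hG)] with Γ h1 h2
    refine max_eq_left (not_lt.1 fun h => ?_)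
    exact absurd ((pREM_lt_pPAR_iff hβ h2.le).1 h) (not_lt.2 h1)
  · rw [pQREM, pPAR_mul_gammaC hβ, max_self]

theorem hasDerivWithinAt_pQREM_right {β : ℝ} (hβ : 0 < β) :
    HasDerivWithinAt (fun Γ => pQREM β Γ) (β * Real.tanh (β * gammaC β))
      (Set.Ici (gammaC β)) (gammaC β) := by
  have hG := gammaC_pos hβ
  have h : HasDerivAt (fun Γ => pPAR (β * Γ)) (β * Real.tanh (β * gammaC β)) (gammaC β) := by
    have h1 : HasDerivAt (fun Γ : ℝ => β * Γ) β (gammaC β) := by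
      simpa using (hasDerivAt_id (gammaC β)).const_mul β
    have := (hasDerivAt_pPAR (β * gammaC β)).comp (gammaC β) h1
    rwa [mul_comm] at this
  refine h.hasDerivWithinAt.congr (fun Γ h1 => ?_) ?_
  · refine max_eq_right (not_lt.1 fun h => ?_)
    exact absurd ((pPAR_lt_pREM_iff hβ (hG.le.trans h1)).1 h) (not_lt.2 h1)
  · rw [pQREM, pPAR_mul_gammaC hβ, max_self]

theorem tanh_pos_of_pos {x : ℝ} (hx : 0 < x) : 0 < Real.tanh x := by
  rw [Real.tanh_eq_sinh_div_cosh]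
  exact div_pos (Real.sinh_pos_iff.2 hx) (Real.cosh_pos x)

theorem hasDerivAt_pREM (β : ℝ) : HasDerivAt pREM (min β betaC) β := by
  have h1 : HasDerivAt (fun b : ℝ => b ^ 2 / 2) β β := by
    have := ((hasDerivAt_id β).pow 2).div_const 2
    simpa using this
  have h2 : HasDerivAt (fun b : ℝ => betaC ^ 2 / 2 + (b - betaC) * betaC) betaC β := by
    have := (((hasDerivAt_id β).sub_const betaC).mul_const betaC).const_add (betaC ^ 2 / 2)
    simpa using this
  rcases lt_trichotomy β betaC with h | h | h
  · rw [min_eq_left h.le]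
    refine h1.congr_of_eventuallyEq ?_
    filter_upwards [gt_mem_nhds h] with b hb
    exact if_pos hb.le
  -- At `β_c` both branches have slope `β_c`, and the one-sided derivatives are glued.
  · rw [min_eq_left h.le]
    rw [← h] at h2
    have hl : HasDerivWithinAt pREM β (Set.Iic β) β :=
      h1.hasDerivWithinAt.congr (fun b hb => if_pos (h ▸ hb)) (if_pos h.le)
    have hr : HasDerivWithinAt pREM β (Set.Ici β) β := by
      refine h2.hasDerivWithinAt.congr (fun b hb => ?_) ?_
      · rw [pREM, ← h]
        split_ifs with hb'
        · rw [le_antisymm hb' hb]; ring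
        · rfl
      · rw [pREM, ← h, if_pos le_rfl]; ring
    have := hl.union hr
    rwa [Set.Iic_union_Ici, hasDerivWithinAt_univ] at this
  · rw [min_eq_right h.le]
    refine h2.congr_of_eventuallyEq ?_
    filter_upwards [lt_mem_nhds h] with b hb
    exact if_neg (not_le.2 hb)

/-- The strict inequality `pPAR < pREM` persists for nearby `β` by continuity, so the maximum is
locally `pREM`. -/
theorem hasDerivAt_pQREM_of_lt_gammaC {β Γ : ℝ} (hβ : 0 < β) (hΓ : 0 ≤ Γ) (h : Γ < gammaC β) :
    HasDerivAt (fun b => pQREM b Γ) (min β betaC) β := by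
  refine (hasDerivAt_pREM β).congr_of_eventuallyEq ?_
  have h1 : ContinuousAt (fun b => pPAR (b * Γ)) β :=
    ContinuousAt.comp (f := fun b : ℝ => b * Γ) (hasDerivAt_pPAR _).continuousAt (by fun_prop)
  filter_upwards [h1.eventually_lt (hasDerivAt_pREM β).continuousAt
    ((pPAR_lt_pREM_iff hβ hΓ).2 h)] with b hb
  exact max_eq_left hb.le

/-- As `log 2 = β_c ^ 2 / 2`, the entropy is `(β_c ^ 2 - β ^ 2) / 2` up to `β_c` and identically
zero beyond. -/
theorem entropy_eq_zero_iff {β Γ : ℝ} (hβ : 0 < β) (hΓ : 0 ≤ Γ) (h : Γ < gammaC β) :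
    Real.log 2 + pQREM β Γ - β * min β betaC = 0 ↔ betaC ≤ β := by
  have hc := betaC_pos
  have hsq := betaC_sq
  rw [pQREM, max_eq_left ((pPAR_lt_pREM_iff hβ hΓ).2 h).le, pREM]
  split_ifs with hle
  · rw [min_eq_left hle]
    constructor
    · intro h0
      nlinarith
    · intro h0
      rw [le_antisymm hle h0]
      linarith
  · rw [min_eq_right (not_le.1 hle).le]
    constructor
    · intro _
      exact (not_le.1 hle).le
    · intro _
      linarith

end PhaseTransitions

end QREM

/-- Limiting pressure of the quantum random energy model, with its first-order transition line
and its freezing transition. For each `N` the variables `g N σ` are i.i.d. standard Gaussian; the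
joint law for different `N` is arbitrary. -/
theorem theorem1 {Ω : Type*} [MeasurableSpace Ω] (P : Measure Ω) [IsProbabilityMeasure P]
    (g : (N : ℕ) → QREM.Config N → Ω → ℝ)
    (hlaw : ∀ (N : ℕ) (σ : QREM.Config N), HasLaw (g N σ) (gaussianReal 0 1) P)
    (hindep : ∀ N : ℕ, iIndepFun (g N) P) :
    -- almost sure convergence of the pressure to Goldschmidt's formula
    (∀ β Γ : ℝ, 0 ≤ β → 0 ≤ Γ → ∀ᵐ ω ∂P,
      Tendsto (fun N : ℕ => QREM.pressure β Γ (fun σ => g N σ ω)) atTop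
        (𝓝 (max (QREM.pREM β) (QREM.pPAR (β * Γ))))) ∧
    -- the first-order transition: which term is the larger one changes at the critical field, where
    -- the derivative of the limit with respect to the field jumps
    (∀ β : ℝ, 0 < β →
      (∀ Γ : ℝ, 0 ≤ Γ →
        (QREM.pPAR (β * Γ) < QREM.pREM β ↔ Γ < QREM.gammaC β) ∧
        (QREM.pREM β < QREM.pPAR (β * Γ) ↔ QREM.gammaC β < Γ)) ∧
      HasDerivWithinAt (fun Γ => QREM.pQREM β Γ) 0
        (Set.Iic (QREM.gammaC β)) (QREM.gammaC β) ∧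
      HasDerivWithinAt (fun Γ => QREM.pQREM β Γ) (β * Real.tanh (β * QREM.gammaC β))
        (Set.Ici (QREM.gammaC β)) (QREM.gammaC β) ∧
      0 < β * Real.tanh (β * QREM.gammaC β)) ∧
    -- the freezing transition: below the critical field the derivative of the limit in the inverse
    -- temperature saturates at `β_c`, and the entropy vanishes exactly from `β_c` on
    (∀ β Γ : ℝ, 0 < β → 0 ≤ Γ → Γ < QREM.gammaC β →
      HasDerivAt (fun b => QREM.pQREM b Γ) (min β QREM.betaC) β ∧
      (Real.log 2 + QREM.pQREM β Γ - β * min β QREM.betaC = 0 ↔ QREM.betaC ≤ β)) := by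
  refine ⟨fun β Γ hβ hΓ => QREM.ae_tendsto_pressure hlaw hindep hβ hΓ, fun β hβ => ⟨fun Γ hΓ =>
    ⟨QREM.pPAR_lt_pREM_iff hβ hΓ, QREM.pREM_lt_pPAR_iff hβ hΓ⟩,
    QREM.hasDerivWithinAt_pQREM_left hβ, QREM.hasDerivWithinAt_pQREM_right hβ,
    mul_pos hβ (QREM.tanh_pos_of_pos (mul_pos hβ (QREM.gammaC_pos hβ)))⟩,
    fun β Γ hβ hΓ h => ⟨QREM.hasDerivAt_pQREM_of_lt_gammaC hβ hΓ h,
      QREM.entropy_eq_zero_iff hβ hΓ h⟩⟩
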